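/- Let $d\in\mathbb N$ and let $T$ be an $L^\infty$ function on $[-\pi,\pi[$ with values in the Hermitian $d\times d$ complex matrices. For $k\in\mathbb Z$ put $$\hat T(k) := \frac1{2\pi}\int_{-\pi}^{\pi} T(\theta)\,e^{-ik\theta}\,d\theta ,$$ let $\hat T := \bigl(\hat T(j-i)\bigr)_{i,j\ge 0}$ be the associated block Toeplitz matrix on $\bigoplus_{0}^{\infty}\mathbb C^d$, and let $P_n$ be the projection onto the first $n$ terms of $\bigoplus_0^\infty\mathbb C^d$. Regard $P_n\hat T P_n$ as the Hermitian $nd\times nd$ principal sub-matrix $\bigl(\hat T(j-i)\bigr)_{0\le i,j<n}$. Let $f:\mathbb R\to\mathbb C$ be absolutely continuous on every compact interval; for a Hermitian matrix $A$, $f(A)$ is defined by the spectral theorem, and $\operatorname{tr}$ is the unnormalized trace. Then $\theta\mapsto \operatorname{tr} f(T(\theta))$ is integrable on $[-\pi,\pi]$ and $$\lim_{n\to\infty}\Bigl(\operatorname{tr} f(P_{n+1}\hat T P_{n+1})-\operatorname{tr} f(P_n\hat T P_n)\Bigr)=\frac1{2\pi}\int_{-\pi}^{\pi}\operatorname{tr}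 f(T(\theta))\,d\theta .$$ -/

import Mathlib

open MeasureTheory Filter Topology

noncomputable section

namespace BlockToeplitz

/-- The function `f : ℝ → ℂ` of a Hermitian matrix `A`, by the spectral theorem: if
`A = U diag(λ) U*` then `f(A) = U diag(f(λ)) U*`.
The value on matrices that are not Hermitian is an irrelevant convention. -/
def hermitianFun {ι : Type*} [Fintype ι] [DecidableEq ι] (f : ℝ → ℂ) (A : Matrix ι ι ℂ) :
    Matrix ι ι ℂ :=
  open Classical in
  if hA : A.IsHermitian then
    (hA.eigenvectorUnitary : Matrix ι ι ℂ) * Matrix.diagonal (fun i => f (hA.eigenvalues i)) *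
      star (hA.eigenvectorUnitary : Matrix ι ι ℂ)
  else 0

/-- The `k`-th Fourier coefficient of a matrix-valued function on `[-π, π[`, entry by entry. -/
def fourierCoeffMatrix {d : ℕ} (T : ℝ → Matrix (Fin d) (Fin d) ℂ) (k : ℤ) :
    Matrix (Fin d) (Fin d) ℂ :=
  Matrix.of fun a b =>
    1 / (2 * (Real.pi : ℂ)) *
      ∫ θ in (-Real.pi)..Real.pi, T θ a b * Complex.exp (-(Complex.I * (k : ℂ) * (θ : ℂ)))

/-- The infinite block Toeplitz matrix with symbol `T`: the `d × d` block in block row `i` and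
block column `j` is the Fourier coefficient of order `j - i`. -/
def blockToeplitz {d : ℕ} (T : ℝ → Matrix (Fin d) (Fin d) ℂ) :
    Matrix (ℕ × Fin d) (ℕ × Fin d) ℂ :=
  Matrix.of fun p q => fourierCoeffMatrix T ((q.1 : ℤ) - (p.1 : ℤ)) p.2 q.2

/-- `P_n M P_n` as an operator on the range of `P_n`, the projection onto the first `n` terms of
`⊕ ℂ^d`: the `nd × nd` principal sub-matrix of `M` on the first `n` blocks. -/
def truncation {d : ℕ} (M : Matrix (ℕ × Fin d) (ℕ × Fin d) ℂ) (n : ℕ) :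
    Matrix (Fin n × Fin d) (Fin n × Fin d) ℂ :=
  M.submatrix (Prod.map Fin.val id) (Prod.map Fin.val id)

/-- For a symbol with Hermitian values, the truncated block Toeplitz matrices are Hermitian, so
`hermitianFun` is only ever applied to Hermitian matrices. -/
theorem truncation_blockToeplitz_isHermitian {d : ℕ} (T : ℝ → Matrix (Fin d) (Fin d) ℂ)
    (hT : ∀ θ ∈ Set.Ico (-Real.pi) Real.pi, (T θ).IsHermitian) (n : ℕ) :
    (truncation (blockToeplitz T) n).IsHermitian := by
  ext ⟨i, a⟩ ⟨j, b⟩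
  simp only [truncation, blockToeplitz, fourierCoeffMatrix, Matrix.conjTranspose_apply,
    Matrix.submatrix_apply, Matrix.of_apply, Prod.map_apply, id_eq]
  have hpi : (-Real.pi) ≤ Real.pi := by linarith [Real.pi_pos]
  rw [intervalIntegral.integral_of_le hpi, intervalIntegral.integral_of_le hpi,
    ← integral_Ico_eq_integral_Ioc, ← integral_Ico_eq_integral_Ioc]
  rw [star_mul']
  congr 1
  · simp
  · refine integral_conj.symm.trans (setIntegral_congr_fun measurableSet_Ico fun θ hθ => ?_)
    have h : (starRingEnd ℂ) (T θ b a) = T θ a b := (hT θ hθ).apply a b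
    simp only [map_mul, h, ← Complex.exp_conj]
    congr 2
    simp
    ring

end BlockToeplitz

end

/-!
Every sum `∑ g(λ)` over the eigenvalues of a Hermitian matrix with spectrum in `[-K, K]` equals
`N(K) g(K) - ∫ g'(t) N(t) dt`, with the integral over `[-K, K]`, where `N(t)` counts the eigenvalues
that are at most `t` (`sum_eigenvalues_eq_sub_integral`). By Cauchy interlacing
(`eigenCount_compression`), the counting functions of two consecutive truncations differ by a number
between `0` and `d`. Hence the increment of the traces is continuous in `g`, uniformly in `n`, for
convergence of `g(K)` together with convergence of `g'` in `L¹(-K, K)`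
(`norm_sum_eigenvalues_sub_le`), and so is the right-hand side of the limit formula. An absolutely
continuous function is a limit of polynomials in this sense
(`exists_polynomial_near_of_absolutelyContinuous`), so the theorem reduces to monomials.

For monomials (`tendsto_trace_truncation_pow`), realize the doubly infinite Toeplitz matrix as the
bounded operator `M` of multiplication by `T` on `L²(circle; ℂ^d)` (`exists_laurent_operator`). By
translation invariance, the diagonal blocks of `k`-th powers of truncations can be computed from the
compression of `M` to any window of consecutive blocks. Compare the `n + 1` diagonal blocks of the
larger matrix with the `n` blocks of the smaller one by removing the last block on the left half and
the first block on the right half. The middle block, which is left over, converges to the diagonal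
block of `M ^ k`, that is, to the mean of `T ^ k`, since the windows centred at it exhaust `ℤ`. All
other contributions tend to zero (`tendsto_sum_inner_compress_pow_sub`): a change in the diagonal is
carried by paths through the removed block `e`, and equals a finite sum of terms
`⟨e, X Y^j P_R X^i e⟩`, where `X` and `Y` are the compressions with and without `e`, and where `P_R` projects onto the
positions that are compared. Here `X^i e` converges in norm while `R` moves off to infinity.
-/

open scoped InnerProductSpace

namespace BlockToeplitz

/-! ### Compressions of an operator to coordinate subspaces -/

theorem ext_hilbertBasis {ι H : Type*} [NormedAddCommGroup H] [InnerProductSpace ℂ H]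
    {b : HilbertBasis ι ℂ H} {A B : H →L[ℂ] H} (h : ∀ i, A (b i) = B (b i)) : A = B := by
  refine ContinuousLinearMap.ext_on (s := Set.range b) ?_ ?_
  · rw [Submodule.dense_iff_topologicalClosure_eq_top]
    exact b.dense_span
  · rintro _ ⟨i, rfl⟩
    exact h i

section Compression

variable {ι H : Type*} [NormedAddCommGroup H] [InnerProductSpace ℂ H] [CompleteSpace H]

/-- The orthogonal projection onto the closed span of the basis vectors `b i` with `i ∈ S`. -/
noncomputable def coordProj (b : HilbertBasis ι ℂ H) (S : Set ι) : H →L[ℂ] H :=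
  (Submodule.span ℂ (b '' S)).topologicalClosure.starProjection

/-- The compression `P_S M P_S` of `M` to the coordinate subspace with index set `S`, as an
operator on the whole space. -/
noncomputable def compress (b : HilbertBasis ι ℂ H) (M : H →L[ℂ] H) (S : Set ι) : H →L[ℂ] H :=
  coordProj b S * M * coordProj b S

variable (b : HilbertBasis ι ℂ H) (M : H →L[ℂ] H)

theorem coordProj_apply_of_mem {S : Set ι} {i : ι} (hi : i ∈ S) : coordProj b S (b i) = b i :=
  Submodule.starProjection_eq_self_iff.2
    (Submodule.le_topologicalClosure _ (Submodule.subset_span ⟨i, hi, rfl⟩))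

theorem coordProj_apply_of_notMem {S : Set ι} {i : ι} (hi : i ∉ S) : coordProj b S (b i) = 0 := by
  rw [coordProj, Submodule.starProjection_apply_eq_zero_iff, Submodule.orthogonal_closure,
    Submodule.mem_orthogonal]
  intro u hu
  induction hu using Submodule.span_induction with
  | mem x hx =>
    obtain ⟨j, hj, rfl⟩ := hx
    exact b.orthonormal.2 (fun h => hi (h ▸ hj))
  | zero => simp
  | add x y _ _ hx hy => simp [inner_add_left, hx, hy]
  | smul c x _ hx => simp [inner_smul_left, hx]

open Classical in
theorem coordProj_apply_basis (S : Set ι) (i : ι) :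
    coordProj b S (b i) = if i ∈ S then b i else 0 := by
  split_ifs with h
  · exact coordProj_apply_of_mem b h
  · exact coordProj_apply_of_notMem b h

theorem norm_coordProj_le (S : Set ι) : ‖coordProj b S‖ ≤ 1 :=
  Submodule.starProjection_norm_le _

theorem norm_coordProj_apply_le (S : Set ι) (x : H) : ‖coordProj b S x‖ ≤ ‖x‖ :=
  Submodule.norm_starProjection_apply_le _ x

theorem inner_coordProj_left (S : Set ι) (x y : H) :
    ⟪coordProj b S x, y⟫_ℂ = ⟪x, coordProj b S y⟫_ℂ :=
  Submodule.inner_starProjection_left_eq_right _ x y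

theorem coordProj_mul (S S' : Set ι) :
    coordProj b S * coordProj b S' = coordProj b (S ∩ S') := by
  classical
  refine ext_hilbertBasis (b := b) fun i => ?_
  by_cases h : i ∈ S' <;> simp [coordProj_apply_basis, h]

theorem coordProj_empty : coordProj b ∅ = 0 :=
  ext_hilbertBasis (b := b) fun i => by simp [coordProj_apply_of_notMem]

theorem coordProj_univ : coordProj b Set.univ = 1 :=
  ext_hilbertBasis (b := b) fun i => by simp [coordProj_apply_of_mem]

theorem coordProj_add_compl (S : Set ι) : coordProj b S + coordProj b Sᶜ = 1 := by
  classical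
  refine ext_hilbertBasis (b := b) fun i => ?_
  by_cases h : i ∈ S <;> simp [coordProj_apply_basis, h]

theorem coordProj_coe_finset (s : Finset ι) (x : H) :
    coordProj b s x = ∑ i ∈ s, ⟪b i, x⟫_ℂ • b i := by
  classical
  have : coordProj b s = ∑ i ∈ s, (innerSL ℂ (b i)).smulRight (b i) := by
    refine ext_hilbertBasis (b := b) fun j => ?_
    have h := orthonormal_iff_ite.1 b.orthonormal
    simp [coordProj_apply_basis, h, ite_smul]
  rw [this]
  simp

/-- Coordinate projections converge strongly when their index sets converge pointwise. -/
theorem tendsto_coordProj {α : Type*} {l : Filter α} {S : α → Set ι} {S₀ : Set ι}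
    (h : ∀ i, ∀ᶠ n in l, (i ∈ S n ↔ i ∈ S₀)) (x : H) :
    Tendsto (fun n => coordProj b (S n) x) l (𝓝 (coordProj b S₀ x)) := by
  classical
  have hspan : ∀ y ∈ Submodule.span ℂ (Set.range b),
      Tendsto (fun n => coordProj b (S n) y) l (𝓝 (coordProj b S₀ y)) := by
    intro y hy
    induction hy using Submodule.span_induction with
    | mem x hx =>
      obtain ⟨j, rfl⟩ := hx
      refine tendsto_const_nhds.congr' ?_
      filter_upwards [h j] with n hn
      simp only [coordProj_apply_basis, hn]
    | zero => simpa using tendsto_const_nhds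
    | add x y _ _ hx hy => simpa using hx.add hy
    | smul c x _ hx => simpa using hx.const_smul c
  rw [Metric.tendsto_nhds]
  intro ε hε
  have hd : Dense (Submodule.span ℂ (Set.range b) : Set H) := by
    rw [Submodule.dense_iff_topologicalClosure_eq_top]
    exact b.dense_span
  obtain ⟨y, hy, hxy⟩ := Metric.dense_iff.1 hd x (ε / 3) (by positivity)
  filter_upwards [Metric.tendsto_nhds.1 (hspan y hxy) (ε / 3) (by positivity)] with n hn
  have h1 : dist (coordProj b (S n) x) (coordProj b (S n) y) ≤ dist x y := by
    rw [dist_eq_norm, dist_eq_norm, ← map_sub]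
    exact norm_coordProj_apply_le b _ _
  have h2 : dist (coordProj b S₀ y) (coordProj b S₀ x) ≤ dist y x := by
    rw [dist_eq_norm, dist_eq_norm, ← map_sub]
    exact norm_coordProj_apply_le b _ _
  have h3 := dist_triangle4 (coordProj b (S n) x) (coordProj b (S n) y) (coordProj b S₀ y)
    (coordProj b S₀ x)
  rw [Metric.mem_ball] at hy
  rw [dist_comm x y] at h1
  linarith

/-- Strong convergence is stable under evaluation at convergent vectors, for contractions. -/
theorem tendsto_coordProj_of_tendsto {α : Type*} {l : Filter α} {S : α → Set ι} {S₀ : Set ι}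
    (h : ∀ i, ∀ᶠ n in l, (i ∈ S n ↔ i ∈ S₀)) {x : α → H} {x₀ : H} (hx : Tendsto x l (𝓝 x₀)) :
    Tendsto (fun n => coordProj b (S n) (x n)) l (𝓝 (coordProj b S₀ x₀)) := by
  have h1 : Tendsto (fun n => coordProj b (S n) (x n - x₀)) l (𝓝 0) := by
    refine squeeze_zero_norm (fun n => norm_coordProj_apply_le b (S n) (x n - x₀)) ?_
    simpa using (hx.sub_const x₀).norm
  simpa using h1.add (tendsto_coordProj b h x₀)

theorem compress_apply (S : Set ι) (x : H) :
    compress b M S x = coordProj b S (M (coordProj b S x)) := rfl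

theorem norm_compress_le (S : Set ι) : ‖compress b M S‖ ≤ ‖M‖ := by
  have h := norm_coordProj_le b S
  calc ‖compress b M S‖ ≤ ‖coordProj b S‖ * ‖M‖ * ‖coordProj b S‖ :=
        (norm_mul_le _ _).trans (by gcongr; exact norm_mul_le _ _)
    _ ≤ 1 * ‖M‖ * 1 := by gcongr
    _ = ‖M‖ := by ring

theorem norm_pow_le_pow_norm (A : H →L[ℂ] H) (k : ℕ) : ‖A ^ k‖ ≤ ‖A‖ ^ k := by
  induction k with
  | zero => simpa only [pow_zero] using! ContinuousLinearMap.norm_id_le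
  | succ k ih =>
    rw [pow_succ, pow_succ]
    exact (norm_mul_le _ _).trans (by gcongr)

theorem tendsto_compress_pow {α : Type*} {l : Filter α} {S : α → Set ι} {S₀ : Set ι}
    (h : ∀ i, ∀ᶠ n in l, (i ∈ S n ↔ i ∈ S₀)) (k : ℕ) (x : H) :
    Tendsto (fun n => (compress b M (S n) ^ k) x) l (𝓝 ((compress b M S₀ ^ k) x)) := by
  induction k with
  | zero => simpa using tendsto_const_nhds
  | succ k ih =>
    simp only [pow_succ', compress, mul_assoc, mul_apply_eq_comp]
    refine tendsto_coordProj_of_tendsto b h ((M.continuous.tendsto _).comp ?_)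
    simpa only [compress, mul_assoc] using tendsto_coordProj_of_tendsto b h ih

/-- Powers of a finite matrix of coefficients of `M` are matrices of coefficients of powers of the
compression of `M`. -/
theorem matrix_pow_apply_eq_inner {κ : Type*} [Fintype κ] [DecidableEq κ] (φ : κ → ι)
    (hφ : Function.Injective φ) (A : Matrix κ κ ℂ)
    (hA : ∀ p q, A p q = ⟪b (φ p), M (b (φ q))⟫_ℂ) (k : ℕ) (p q : κ) :
    (A ^ k) p q = ⟪b (φ p), (compress b M (Set.range φ) ^ k) (b (φ q))⟫_ℂ := by
  classical
  induction k generalizing p with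
  | zero =>
    simp [Matrix.one_apply, orthonormal_iff_ite.1 b.orthonormal, hφ.eq_iff]
  | succ k ih =>
    have hr : Set.range φ = (Finset.univ.image φ : Finset ι) := by simp
    have hP : ∀ v, coordProj b (Set.range φ) v = ∑ r, ⟪b (φ r), v⟫_ℂ • b (φ r) := by
      intro v
      rw [hr, coordProj_coe_finset, Finset.sum_image hφ.injOn]
    rw [pow_succ', Matrix.mul_apply, pow_succ', mul_apply_eq_comp]
    have hp : coordProj b (Set.range φ) (b (φ p)) = b (φ p) :=
      coordProj_apply_of_mem b (Set.mem_range_self p)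
    rw [compress_apply, ← inner_coordProj_left, hp, hP, map_sum, inner_sum]
    refine Finset.sum_congr rfl fun r _ => ?_
    rw [map_smul, inner_smul_right, hA, ih, mul_comm]

/-- Removing a coordinate set `E` from the compression set changes powers only through paths that
visit `E`: the summand with index `j` collects the paths from `r` that reach `E` for the first time
at step `j + 1`. -/
theorem compress_pow_sub_apply {S E : Set ι} (hSE : Disjoint S E) (k : ℕ) {r : ι} (hr : r ∉ E) :
    (compress b M (S ∪ E) ^ k) (b r) - (compress b M S ^ k) (b r) =
      ∑ j ∈ Finset.range k, (compress b M (S ∪ E) ^ (k - 1 - j))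
        (coordProj b E ((compress b M (S ∪ E)) ((compress b M S ^ j) (b r)))) := by
  set X := compress b M (S ∪ E) with hX
  set Y := compress b M S with hY
  set Q := coordProj b Eᶜ with hQ
  have hS1 : Eᶜ ∩ (S ∪ E) = S := by
    ext i
    have : i ∈ S → i ∉ E := fun h => Set.disjoint_left.1 hSE h
    simp only [Set.mem_inter_iff, Set.mem_compl_iff, Set.mem_union]
    tauto
  have hS2 : (S ∪ E) ∩ Eᶜ = S := by rw [Set.inter_comm, hS1]
  have hYX : Y = Q * X * Q := by
    have h1 : coordProj b S = Q * coordProj b (S ∪ E) := by rw [hQ, coordProj_mul, hS1]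
    have h2 : coordProj b S = coordProj b (S ∪ E) * Q := by rw [hQ, coordProj_mul, hS2]
    calc Y = coordProj b S * M * coordProj b S := rfl
      _ = (Q * coordProj b (S ∪ E)) * M * (coordProj b (S ∪ E) * Q) := by rw [← h1, ← h2]
      _ = Q * X * Q := by simp only [hX, compress, mul_assoc]
  have hQQ : Q * Q = Q := by rw [hQ, coordProj_mul, Set.inter_self]
  have hQY : ∀ j, Q ((Y ^ j) (b r)) = (Y ^ j) (b r) := by
    intro j
    cases j with
    | zero => simpa using coordProj_apply_of_mem b (S := Eᶜ) hr
    | succ j =>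
      rw [pow_succ', mul_apply_eq_comp, ← mul_apply_eq_comp, hYX,
        ← mul_assoc, ← mul_assoc, hQQ]
  have hstep : ∀ j, X ((Y ^ j) (b r)) - (Y ^ (j + 1)) (b r) =
      coordProj b E (X ((Y ^ j) (b r))) := by
    intro j
    have h1 : (Y ^ (j + 1)) (b r) = Q (X ((Y ^ j) (b r))) := by
      have h3 : ∀ x, Y x = Q (X (Q x)) := fun x => by rw [hYX]; rfl
      rw [pow_succ', mul_apply_eq_comp, h3, hQY]
    have h2 := congrArg (fun A : H →L[ℂ] H => A (X ((Y ^ j) (b r)))) (coordProj_add_compl b E)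
    simp only [add_apply, one_apply_eq_self] at h2
    rw [h1, sub_eq_iff_eq_add]
    exact h2.symm
  induction k with
  | zero => simp
  | succ k ih =>
    rw [Finset.sum_range_succ, ← hstep k]
    have h3 : ∀ j ∈ Finset.range k, (X ^ (k + 1 - 1 - j))
        (coordProj b E (X ((Y ^ j) (b r)))) = X ((X ^ (k - 1 - j))
        (coordProj b E (X ((Y ^ j) (b r))))) := by
      intro j hj
      have : k + 1 - 1 - j = (k - 1 - j) + 1 := by have := Finset.mem_range.1 hj; omega
      rw [this, pow_succ', mul_apply_eq_comp]
    rw [Finset.sum_congr rfl h3, ← map_sum, ← ih, map_sub]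
    simp [pow_succ']

end Compression

/-! ### Increments of traces of powers -/

section Increments

variable {ι H : Type*} [NormedAddCommGroup H] [InnerProductSpace ℂ H] [CompleteSpace H]

/-- The diagonal coefficients, at positions `R`, of `X ^ k - Y ^ k` for the compressions `X`, `Y`
to `S ∪ E` and `S`: cyclicity of the trace moves the projection onto `R` inside. -/
theorem sum_inner_compress_pow_sub (b : HilbertBasis ι ℂ H) (M : H →L[ℂ] H) {S : Set ι}
    {E R : Finset ι} (hSE : Disjoint S (E : Set ι)) (hRE : Disjoint R E) (k : ℕ) :
    ∑ r ∈ R, (⟪b r, (compress b M (S ∪ E) ^ k) (b r)⟫_ℂ - ⟪b r, (compress b M S ^ k) (b r)⟫_ℂ) =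
      ∑ j ∈ Finset.range k, ∑ a ∈ E, ⟪b a, compress b M (S ∪ E) ((compress b M S ^ j)
        (coordProj b R ((compress b M (S ∪ E) ^ (k - 1 - j)) (b a))))⟫_ℂ := by
  have h1 : ∀ r ∈ R, ⟪b r, (compress b M (S ∪ E) ^ k) (b r)⟫_ℂ -
      ⟪b r, (compress b M S ^ k) (b r)⟫_ℂ = ∑ j ∈ Finset.range k, ∑ a ∈ E,
        ⟪b a, compress b M (S ∪ E) ((compress b M S ^ j) (b r))⟫_ℂ *
        ⟪b r, (compress b M (S ∪ E) ^ (k - 1 - j)) (b a)⟫_ℂ := by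
    intro r hr
    have hrE : r ∉ (E : Set ι) := fun h => Finset.disjoint_left.1 hRE hr h
    rw [← inner_sub_right, compress_pow_sub_apply b M hSE k hrE, inner_sum]
    refine Finset.sum_congr rfl fun j _ => ?_
    rw [coordProj_coe_finset, map_sum, inner_sum]
    refine Finset.sum_congr rfl fun a _ => ?_
    rw [map_smul, inner_smul_right]
  rw [Finset.sum_congr rfl h1, Finset.sum_comm]
  refine Finset.sum_congr rfl fun j _ => ?_
  rw [Finset.sum_comm]
  refine Finset.sum_congr rfl fun a _ => ?_
  rw [coordProj_coe_finset]
  simp only [map_sum, map_smul, inner_sum, inner_smul_right]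
  exact Finset.sum_congr rfl fun r _ => mul_comm _ _

/-- Far away from the finite set `E`, adding `E` to the compression set has asymptotically no effect
on the trace of powers. -/
theorem tendsto_sum_inner_compress_pow_sub (b : HilbertBasis ι ℂ H) (M : H →L[ℂ] H) (E : Finset ι)
    {S : ℕ → Set ι} {S₀ : Set ι} (hS : ∀ i, ∀ᶠ n in atTop, (i ∈ S n ↔ i ∈ S₀))
    (hSE : ∀ n, Disjoint (S n) (E : Set ι)) {R : ℕ → Finset ι}
    (hR : ∀ i, ∀ᶠ n in atTop, i ∉ R n) (hRE : ∀ n, Disjoint (R n) E) (k : ℕ) :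
    Tendsto (fun n => ∑ r ∈ R n, (⟪b r, (compress b M (S n ∪ E) ^ k) (b r)⟫_ℂ -
      ⟪b r, (compress b M (S n) ^ k) (b r)⟫_ℂ)) atTop (𝓝 0) := by
  simp_rw [fun n => sum_inner_compress_pow_sub b M (hSE n) (hRE n) k]
  rw [show (0 : ℂ) = ∑ j ∈ Finset.range k, ∑ a ∈ E, 0 by simp]
  refine tendsto_finsetSum _ fun j _ => tendsto_finsetSum _ fun a _ => ?_
  have hSE' : ∀ i, ∀ᶠ n in atTop, (i ∈ S n ∪ (E : Set ι) ↔ i ∈ S₀ ∪ (E : Set ι)) := fun i => by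
    filter_upwards [hS i] with n hn
    simp [hn]
  have hR' : ∀ i, ∀ᶠ n in atTop, (i ∈ (R n : Set ι) ↔ i ∈ (∅ : Set ι)) := fun i => by
    filter_upwards [hR i] with n hn
    simp [hn]
  have h0 := tendsto_coordProj_of_tendsto b hR'
    (tendsto_compress_pow b M hSE' (k - 1 - j) (b a))
  rw [coordProj_empty, zero_apply, tendsto_zero_iff_norm_tendsto_zero] at h0
  have h1 := h0.const_mul (‖M‖ * ‖M‖ ^ j)
  rw [mul_zero] at h1
  refine squeeze_zero_norm (fun n => ?_) h1
  refine (norm_inner_le_norm _ _).trans ?_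
  rw [b.orthonormal.1 a, one_mul, mul_assoc]
  refine ContinuousLinearMap.le_of_opNorm_le_of_le _ (norm_compress_le b M _) ?_
  refine ContinuousLinearMap.le_of_opNorm_le _ ((norm_pow_le_pow_norm _ j).trans ?_) _
  have := norm_compress_le b M (S n)
  gcongr

variable {d : ℕ}

/-- The indices of `n` consecutive blocks of size `d`, starting with the block `c`. -/
noncomputable def blockWindow (d : ℕ) (c : ℤ) (n : ℕ) : Finset (ℤ × Fin d) :=
  Finset.Ico c (c + n) ×ˢ Finset.univ

/-- The trace of the `i`-th diagonal block of the `k`-th power of the compression of `M` to the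
blocks `c, …, c + n - 1`. -/
noncomputable def blockTrace (b : HilbertBasis (ℤ × Fin d) ℂ H) (M : H →L[ℂ] H) (k : ℕ) (c : ℤ)
    (n : ℕ) (i : ℤ) : ℂ :=
  ∑ a, ⟪b (i, a), (compress b M (blockWindow d c n) ^ k) (b (i, a))⟫_ℂ

/-- The diagonal blocks of powers of a truncated Toeplitz matrix may be read off from any window of
the same length. -/
theorem truncation_pow_diag_eq (T : ℝ → Matrix (Fin d) (Fin d) ℂ)
    (b : HilbertBasis (ℤ × Fin d) ℂ H) (M : H →L[ℂ] H)
    (hM : ∀ p q, ⟪b p, M (b q)⟫_ℂ = fourierCoeffMatrix T (q.1 - p.1) p.2 q.2)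
    (k n : ℕ) (c : ℤ) (i : Fin n) :
    ∑ a, (truncation (blockToeplitz T) n ^ k) (i, a) (i, a) = blockTrace b M k c n (c + i) := by
  refine Finset.sum_congr rfl fun a _ => ?_
  let φ : Fin n × Fin d → ℤ × Fin d := fun p => (c + (p.1 : ℕ), p.2)
  have hφ : Function.Injective φ := by
    rintro ⟨i, a⟩ ⟨j, a'⟩ h
    simp only [φ, Prod.mk.injEq, add_right_inj, Nat.cast_inj, Fin.val_inj] at h
    exact Prod.ext h.1 h.2
  have hrange : Set.range φ = (blockWindow d c n : Set (ℤ × Fin d)) := by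
    ext ⟨i, a⟩
    simp only [φ, Set.mem_range, Prod.exists, Prod.mk.injEq, blockWindow, Finset.coe_product,
      Finset.coe_Ico, Finset.coe_univ, Set.mem_prod, Set.mem_Ico, Set.mem_univ, and_true]
    constructor
    · rintro ⟨j, _, rfl, _⟩
      have := j.2
      omega
    · rintro ⟨h1, h2⟩
      exact ⟨⟨(i - c).toNat, by omega⟩, a, by simp only; omega, rfl⟩
  rw [matrix_pow_apply_eq_inner b M φ hφ _ (fun p q => ?_) k, hrange]
  rw [hM]
  simp [φ, truncation, blockToeplitz]

/-- The limit theorem for monomials, in terms of a bounded operator `M` with the Toeplitz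
coefficients. Powers of the matrices of sizes `n + 1` and `n` are compared block by block along the
diagonal, with the middle block of the larger one left over. -/
theorem tendsto_trace_truncation_pow (T : ℝ → Matrix (Fin d) (Fin d) ℂ)
    (b : HilbertBasis (ℤ × Fin d) ℂ H) (M : H →L[ℂ] H)
    (hM : ∀ p q, ⟪b p, M (b q)⟫_ℂ = fourierCoeffMatrix T (q.1 - p.1) p.2 q.2) (k : ℕ) :
    Tendsto (fun n => (truncation (blockToeplitz T) (n + 1) ^ k).trace -
        (truncation (blockToeplitz T) n ^ k).trace) atTop
      (𝓝 (∑ a, ⟪b (0, a), (M ^ k) (b (0, a))⟫_ℂ)) := by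
  have hshift : ∀ (n : ℕ) (c i : ℤ), c ≤ i → i < c + n →
      blockTrace b M k c n i = blockTrace b M k 0 n (i - c) := by
    intro n c i h1 h2
    have e1 := truncation_pow_diag_eq T b M hM k n c ⟨(i - c).toNat, by omega⟩
    have e2 := truncation_pow_diag_eq T b M hM k n 0 ⟨(i - c).toNat, by omega⟩
    have hc : ((i - c).toNat : ℤ) = i - c := by omega
    simp only [hc] at e1 e2
    rw [zero_add] at e2
    rw [← e2, e1]
    congr 1
    ring
  have htrace : ∀ n, (truncation (blockToeplitz T) n ^ k).trace =
      ∑ i ∈ Finset.range n, blockTrace b M k 0 n i := by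
    intro n
    rw [Matrix.trace, Fintype.sum_prod_type, Finset.sum_range]
    refine Finset.sum_congr rfl fun i _ => ?_
    simpa using truncation_pow_diag_eq T b M hM k n 0 i
  -- The block in the middle, seen from a window centred at it.
  have hmid : Tendsto (fun n : ℕ => blockTrace b M k (-((n / 2 : ℕ) : ℤ)) (n + 1) 0) atTop
      (𝓝 (∑ a, ⟪b (0, a), (M ^ k) (b (0, a))⟫_ℂ)) := by
    refine tendsto_finsetSum _ fun a _ => ?_
    have h := tendsto_compress_pow b M (l := atTop) (S₀ := Set.univ)
      (S := fun n : ℕ => (blockWindow d (-((n / 2 : ℕ) : ℤ)) (n + 1) : Set (ℤ × Fin d)))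
      (fun i => by
        filter_upwards [eventually_ge_atTop (2 * i.1.natAbs + 2)] with n hn
        simp [blockWindow]
        omega) k (b (0, a))
    have hu : compress b M Set.univ = M := by simp [compress, coordProj_univ]
    rw [hu] at h
    exact tendsto_const_nhds.inner h
  let E : Finset (ℤ × Fin d) := {0} ×ˢ Finset.univ
  -- The blocks left of the middle, seen from the block that is removed on the right.
  have hleft : Tendsto (fun n : ℕ => ∑ i ∈ Finset.Ico (-(n : ℤ)) ((n / 2 : ℕ) - (n : ℤ)),
      (blockTrace b M k (-n) (n + 1) i - blockTrace b M k (-n) n i)) atTop (𝓝 0) := by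
    have h := tendsto_sum_inner_compress_pow_sub b M E (S₀ := {p | p.1 < 0})
      (S := fun n : ℕ => (blockWindow d (-n) n : Set (ℤ × Fin d)))
      (R := fun n : ℕ => Finset.Ico (-(n : ℤ)) ((n / 2 : ℕ) - (n : ℤ)) ×ˢ Finset.univ)
      (fun i => by
        filter_upwards [eventually_ge_atTop i.1.natAbs] with n hn
        simp [blockWindow]
        omega)
      (fun n => by
        rw [Finset.disjoint_coe, Finset.disjoint_left]
        rintro ⟨i, a⟩ h1 h2
        simp [blockWindow, E] at h1 h2
        omega)
      (fun i => by
        filter_upwards [eventually_ge_atTop (2 * i.1.natAbs + 2)] with n hn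
        simp
        omega)
      (fun n => by
        rw [Finset.disjoint_left]
        rintro ⟨i, a⟩ h1 h2
        simp [E] at h1 h2
        omega) k
    refine h.congr fun n => ?_
    rw [Finset.sum_product]
    have hw : (blockWindow d (-n) n : Set (ℤ × Fin d)) ∪ E = blockWindow d (-n) (n + 1) := by
      ext ⟨i, a⟩
      simp [blockWindow, E]
      omega
    refine Finset.sum_congr rfl fun i _ => ?_
    rw [hw, blockTrace, blockTrace, ← Finset.sum_sub_distrib]
  -- The blocks right of the middle, seen from the block that is removed on the left.
  have hright : Tendsto (fun n : ℕ => ∑ i ∈ Finset.Ico ((n / 2 : ℕ) + 1 : ℤ) (n + 1),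
      (blockTrace b M k 0 (n + 1) i - blockTrace b M k 1 n i)) atTop (𝓝 0) := by
    have h := tendsto_sum_inner_compress_pow_sub b M E (S₀ := {p | 0 < p.1})
      (S := fun n : ℕ => (blockWindow d 1 n : Set (ℤ × Fin d)))
      (R := fun n : ℕ => Finset.Ico ((n / 2 : ℕ) + 1 : ℤ) (n + 1) ×ˢ Finset.univ)
      (fun i => by
        filter_upwards [eventually_ge_atTop i.1.natAbs] with n hn
        simp [blockWindow]
        omega)
      (fun n => by
        rw [Finset.disjoint_coe, Finset.disjoint_left]
        rintro ⟨i, a⟩ h1 h2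
        simp [blockWindow, E] at h1 h2
        omega)
      (fun i => by
        filter_upwards [eventually_ge_atTop (2 * i.1.natAbs + 2)] with n hn
        simp
        omega)
      (fun n => by
        rw [Finset.disjoint_left]
        rintro ⟨i, a⟩ h1 h2
        simp [E] at h1 h2
        omega) k
    refine h.congr fun n => ?_
    rw [Finset.sum_product]
    have hw : (blockWindow d 1 n : Set (ℤ × Fin d)) ∪ E = blockWindow d 0 (n + 1) := by
      ext ⟨i, a⟩
      simp [blockWindow, E]
      omega
    refine Finset.sum_congr rfl fun i _ => ?_
    rw [hw, blockTrace, blockTrace, ← Finset.sum_sub_distrib]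
  have hIco : ∀ (u v : ℤ) (m : ℕ), v = u + m → ∀ g : ℤ → ℂ,
      ∑ i ∈ Finset.Ico u v, g i = ∑ i ∈ Finset.range m, g (u + i) := by
    rintro u _ m rfl g
    refine (Finset.sum_nbij' (fun i : ℕ => u + i) (fun i => (i - u).toNat) ?_ ?_ ?_ ?_ ?_).symm <;>
    · intro i hi
      simp at *
      try omega
  have h := (hmid.add hleft).add hright
  rw [add_zero, add_zero] at h
  refine h.congr fun n => ?_
  obtain ⟨m, m', hm, hn⟩ : ∃ m m' : ℕ, n / 2 = m ∧ n = m + m' := ⟨n / 2, n - n / 2, rfl, by omega⟩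
  rw [hm, htrace, htrace, hIco _ _ m (by ring), hIco _ _ m' (by rw [hn]; push_cast; ring)]
  have hs1 : ∑ i ∈ Finset.range (n + 1), blockTrace b M k 0 (n + 1) i =
      (∑ i ∈ Finset.range m, blockTrace b M k 0 (n + 1) i) + blockTrace b M k 0 (n + 1) m +
      ∑ i ∈ Finset.range m', blockTrace b M k 0 (n + 1) ((m + 1 + i : ℕ) : ℤ) := by
    rw [show n + 1 = (m + 1) + m' by omega, Finset.sum_range_add, Finset.sum_range_succ]
  have hs2 : ∑ i ∈ Finset.range n, blockTrace b M k 0 n i =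
      (∑ i ∈ Finset.range m, blockTrace b M k 0 n i) +
      ∑ i ∈ Finset.range m', blockTrace b M k 0 n ((m + i : ℕ) : ℤ) := by
    subst hn
    rw [Finset.sum_range_add]
  rw [hs1, hs2, hshift (n + 1) (-m) 0 (by omega) (by omega)]
  have h1 : ∀ i ∈ Finset.range m, blockTrace b M k (-n) (n + 1) (-n + i) -
      blockTrace b M k (-n) n (-n + i) = blockTrace b M k 0 (n + 1) i - blockTrace b M k 0 n i := by
    intro i hi
    have := Finset.mem_range.1 hi
    rw [hshift (n + 1) (-n) _ (by omega) (by omega), hshift n (-n) _ (by omega) (by omega)]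
    simp
  have h2 : ∀ i ∈ Finset.range m', blockTrace b M k 0 (n + 1) ((m : ℤ) + 1 + i) -
      blockTrace b M k 1 n ((m : ℤ) + 1 + i) = blockTrace b M k 0 (n + 1) ((m + 1 + i : ℕ) : ℤ) -
      blockTrace b M k 0 n ((m + i : ℕ) : ℤ) := by
    intro i hi
    have := Finset.mem_range.1 hi
    rw [hshift n 1 _ (by omega) (by omega)]
    congr 2
    push_cast
    ring
  rw [Finset.sum_congr rfl h1, Finset.sum_congr rfl h2, Finset.sum_sub_distrib,
    Finset.sum_sub_distrib, sub_neg_eq_add, zero_add]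
  ring

end Increments

/-! ### Multiplication by a bounded matrix symbol -/

section Symbol

open AddCircle

variable {d : ℕ} {P : ℝ} [hP : Fact (0 < P)]

/-- The Hilbert space `L²(circle; ℂ^d)`, as an `ℓ²`-sum of `d` copies of `L²(circle)`. -/
abbrev VectorL2 (d : ℕ) (P : ℝ) [Fact (0 < P)] : Type :=
  PiLp 2 fun _ : Fin d => Lp ℂ 2 (haarAddCircle (T := P))

/-- The vector-valued monomial `exp(-2πi j θ / P) ⊗ δ_a`, for `p = (j, a)`. The sign of the exponent
matches the convention that block `(i, j)` of a Toeplitz matrix is the coefficient of order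
`j - i`. -/
noncomputable def vectorFourier (P : ℝ) [Fact (0 < P)] (p : ℤ × Fin d) : VectorL2 d P :=
  PiLp.single 2 p.2 (fourierLp 2 (-p.1))

theorem vectorFourier_apply (p : ℤ × Fin d) (a : Fin d) :
    vectorFourier P p a = if a = p.2 then fourierLp 2 (-p.1) else 0 := by
  rw [vectorFourier, PiLp.single_apply]

theorem inner_vectorFourier_left (p : ℤ × Fin d) (x : VectorL2 d P) :
    ⟪vectorFourier P p, x⟫_ℂ = fourierCoeff (x p.2) (-p.1) := by
  rw [PiLp.inner_apply, Finset.sum_eq_single p.2]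
  · rw [vectorFourier_apply, if_pos rfl, ← fourierBasis_repr, HilbertBasis.repr_apply_apply,
      coe_fourierBasis]
  · intro a _ ha
    rw [vectorFourier_apply, if_neg ha, inner_zero_left]
  · simp

theorem orthonormal_vectorFourier : Orthonormal ℂ (vectorFourier (d := d) P) := by
  rw [orthonormal_iff_ite]
  rintro ⟨i, a⟩ ⟨j, c⟩
  rw [inner_vectorFourier_left, vectorFourier_apply, ← fourierBasis_repr,
    HilbertBasis.repr_apply_apply, coe_fourierBasis]
  have h := orthonormal_iff_ite.1 (orthonormal_fourier (T := P)) (-i) (-j)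
  by_cases hac : a = c
  · simp [hac, h]
  · simp [hac]

/-- The Hilbert basis of `L²(circle; ℂ^d)` made of the vector-valued monomials. -/
noncomputable def vectorFourierBasis (d : ℕ) (P : ℝ) [Fact (0 < P)] :
    HilbertBasis (ℤ × Fin d) ℂ (VectorL2 d P) :=
  HilbertBasis.mkOfOrthogonalEqBot (orthonormal_vectorFourier (d := d) (P := P)) <| by
    rw [Submodule.eq_bot_iff]
    intro x hx
    ext1 a
    have h : fourierBasis.repr (x a) = 0 := by
      ext i
      have := (Submodule.mem_orthogonal _ _).1 hx (vectorFourier P (-i, a))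
        (Submodule.subset_span ⟨_, rfl⟩)
      rw [inner_vectorFourier_left, neg_neg, ← fourierBasis_repr] at this
      exact this
    exact (LinearIsometryEquiv.map_eq_zero_iff _).1 h

theorem vectorFourierBasis_apply (p : ℤ × Fin d) :
    vectorFourierBasis d P p = vectorFourier P p := by
  rw [vectorFourierBasis, HilbertBasis.coe_mkOfOrthogonalEqBot]

/-- Multiplication by an essentially bounded function, as an operator on `L²`. -/
noncomputable def mulOp {u : AddCircle P → ℂ} (hu : MemLp u ⊤ haarAddCircle) :
    Lp ℂ 2 (haarAddCircle (T := P)) →L[ℂ] Lp ℂ 2 (haarAddCircle (T := P)) :=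
  (ContinuousLinearMap.mul ℂ ℂ).holderL haarAddCircle ⊤ 2 2 (hu.toLp u)

theorem coeFn_mulOp {u : AddCircle P → ℂ} (hu : MemLp u ⊤ haarAddCircle)
    (x : Lp ℂ 2 (haarAddCircle (T := P))) :
    mulOp hu x =ᵐ[haarAddCircle] fun θ => u θ * x θ := by
  refine ((ContinuousLinearMap.mul ℂ ℂ).coeFn_holder (hu.toLp u) x).trans ?_
  filter_upwards [hu.coeFn_toLp] with θ h
  rw [h]
  rfl

/-- Pointwise multiplication by a matrix-valued function with essentially bounded entries. -/
noncomputable def symbolOp {g : AddCircle P → Matrix (Fin d) (Fin d) ℂ}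
    (hg : ∀ a c, MemLp (fun θ => g θ a c) ⊤ haarAddCircle) : VectorL2 d P →L[ℂ] VectorL2 d P :=
  (PiLp.continuousLinearEquiv 2 ℂ _).symm.toContinuousLinearMap ∘L
    ContinuousLinearMap.pi fun a => ∑ c, mulOp (hg a c) ∘L PiLp.proj 2 _ c

theorem coeFn_symbolOp {g : AddCircle P → Matrix (Fin d) (Fin d) ℂ}
    (hg : ∀ a c, MemLp (fun θ => g θ a c) ⊤ haarAddCircle) (x : VectorL2 d P) (a : Fin d) :
    symbolOp hg x a =ᵐ[haarAddCircle] fun θ => ∑ c, g θ a c * x c θ := by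
  have h1 : symbolOp hg x a = ∑ c, mulOp (hg a c) (x c) := by
    simp [symbolOp]
  rw [h1]
  refine (Lp.coeFn_finsetSum _ _).trans ?_
  have h2 : ∀ᵐ θ ∂(haarAddCircle (T := P)), ∀ c, mulOp (hg a c) (x c) θ = g θ a c * x c θ :=
    ae_all_iff.2 fun c => coeFn_mulOp (hg a c) (x c)
  filter_upwards [h2] with θ h
  simp [h]

theorem coeFn_symbolOp_pow {g : AddCircle P → Matrix (Fin d) (Fin d) ℂ}
    (hg : ∀ a c, MemLp (fun θ => g θ a c) ⊤ haarAddCircle) (k : ℕ) (p : ℤ × Fin d) (a : Fin d) :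
    (symbolOp hg ^ k) (vectorFourier P p) a =ᵐ[haarAddCircle]
      fun θ => (g θ ^ k) a p.2 * fourier (-p.1) θ := by
  induction k generalizing a with
  | zero =>
    simp only [pow_zero, one_apply_eq_self, vectorFourier_apply, Matrix.one_apply, ite_mul, one_mul,
      zero_mul]
    split_ifs with h
    · exact coeFn_fourierLp 2 _
    · exact Lp.coeFn_zero _ _ _
  | succ k ih =>
    rw [pow_succ', mul_apply_eq_comp]
    refine (coeFn_symbolOp hg _ a).trans ?_
    filter_upwards [ae_all_iff.2 ih] with θ h
    simp only [h, pow_succ', Matrix.mul_apply, Finset.sum_mul, mul_assoc]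

/-- The matrix coefficients of powers of a multiplication operator are Fourier coefficients of
powers of the symbol. -/
theorem inner_symbolOp_pow {g : AddCircle P → Matrix (Fin d) (Fin d) ℂ}
    (hg : ∀ a c, MemLp (fun θ => g θ a c) ⊤ haarAddCircle) (k : ℕ) (p q : ℤ × Fin d) :
    ⟪vectorFourierBasis d P p, (symbolOp hg ^ k) (vectorFourierBasis d P q)⟫_ℂ =
      fourierCoeff (fun θ => (g θ ^ k) p.2 q.2) (q.1 - p.1) := by
  rw [vectorFourierBasis_apply, vectorFourierBasis_apply, inner_vectorFourier_left]
  refine integral_congr_ae ?_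
  filter_upwards [coeFn_symbolOp_pow hg k q p.2] with θ h
  rw [h, neg_neg, show -(q.1 - p.1) = p.1 + -q.1 by ring, fourier_add]
  simp only [smul_eq_mul]
  ring

end Symbol

section Interval

variable {d : ℕ}

theorem fourierCoeff_liftIoc_two_pi [Fact (0 < 2 * Real.pi)] (u : ℝ → ℂ) (n : ℤ) :
    fourierCoeff (AddCircle.liftIoc (2 * Real.pi) (-Real.pi) u) n =
      1 / (2 * (Real.pi : ℂ)) * ∫ θ in (-Real.pi)..Real.pi,
        u θ * Complex.exp (-(Complex.I * (n : ℂ) * (θ : ℂ))) := by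
  have hpi := Real.pi_pos
  rw [fourierCoeff_eq_intervalIntegral _ n (-Real.pi),
    show -Real.pi + 2 * Real.pi = Real.pi by ring,
    Complex.real_smul]
  congr 1
  · push_cast
    rfl
  · rw [intervalIntegral.integral_of_le (by linarith),
      intervalIntegral.integral_of_le (by linarith)]
    refine setIntegral_congr_fun measurableSet_Ioc fun θ hθ => ?_
    have hθ' : θ ∈ Set.Ioc (-Real.pi) (-Real.pi + 2 * Real.pi) :=
      ⟨hθ.1, by linarith [hθ.2]⟩
    rw [AddCircle.liftIoc_coe_apply hθ', fourier_coe_apply, smul_eq_mul, mul_comm]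
    congr 2
    have : (Real.pi : ℂ) ≠ 0 := by exact_mod_cast hpi.ne'
    push_cast
    field_simp

/-- A realization of the doubly infinite block Toeplitz matrix with bounded symbol `T` as a bounded
operator, together with the diagonal coefficients of its powers. -/
theorem exists_laurent_operator (T : ℝ → Matrix (Fin d) (Fin d) ℂ)
    (hT : ∀ a b : Fin d,
      MemLp (fun θ => T θ a b) ⊤ (volume.restrict (Set.Ico (-Real.pi) Real.pi))) :
    ∃ (H : Type) (_ : NormedAddCommGroup H) (_ : InnerProductSpace ℂ H) (_ : CompleteSpace H)
      (b : HilbertBasis (ℤ × Fin d) ℂ H) (M : H →L[ℂ] H),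
      (∀ p q, ⟪b p, M (b q)⟫_ℂ = fourierCoeffMatrix T (q.1 - p.1) p.2 q.2) ∧
      ∀ (k : ℕ) (a : Fin d), ⟪b (0, a), (M ^ k) (b (0, a))⟫_ℂ =
        1 / (2 * (Real.pi : ℂ)) * ∫ θ in (-Real.pi)..Real.pi, (T θ ^ k) a a := by
  have : Fact (0 < 2 * Real.pi) := ⟨Real.two_pi_pos⟩
  let g : AddCircle (2 * Real.pi) → Matrix (Fin d) (Fin d) ℂ :=
    AddCircle.liftIoc (2 * Real.pi) (-Real.pi) T
  have hgk : ∀ (k : ℕ) (a c : Fin d), (fun θ => (g θ ^ k) a c) =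
      AddCircle.liftIoc (2 * Real.pi) (-Real.pi) (fun θ => (T θ ^ k) a c) := fun k a c => rfl
  have hg : ∀ a c, MemLp (fun θ => g θ a c) ⊤ AddCircle.haarAddCircle := by
    intro a c
    rw [memLp_haarAddCircle_iff]
    refine MemLp.memLp_liftIoc (t := -Real.pi) (f := fun θ => T θ a c) ?_
    rw [show -Real.pi + 2 * Real.pi = Real.pi by ring, ← restrict_Ico_eq_restrict_Ioc]
    exact hT a c
  refine ⟨VectorL2 d (2 * Real.pi), inferInstance, inferInstance, inferInstance,
    vectorFourierBasis d (2 * Real.pi), symbolOp hg, fun p q => ?_, fun k a => ?_⟩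
  · have h := inner_symbolOp_pow hg 1 p q
    rw [pow_one, hgk, fourierCoeff_liftIoc_two_pi] at h
    simpa [fourierCoeffMatrix] using h
  · rw [inner_symbolOp_pow, hgk, fourierCoeff_liftIoc_two_pi]
    simp

end Interval

/-! ### Eigenvalues of Hermitian matrices -/

section Eigenvalues

open Matrix

variable {κ κ' : Type*} [Fintype κ] [DecidableEq κ] [Fintype κ'] [DecidableEq κ']

theorem trace_unitary_conj (U : Matrix.unitaryGroup κ ℂ) (D : Matrix κ κ ℂ) :
    ((U : Matrix κ κ ℂ) * D * star (U : Matrix κ κ ℂ)).trace = D.trace := by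
  rw [Matrix.trace_mul_comm, ← Matrix.mul_assoc, Unitary.coe_star_mul_self, Matrix.one_mul]

theorem trace_hermitianFun {A : Matrix κ κ ℂ} (hA : A.IsHermitian) (f : ℝ → ℂ) :
    (hermitianFun f A).trace = ∑ i, f (hA.eigenvalues i) := by
  rw [hermitianFun, dif_pos hA, trace_unitary_conj, Matrix.trace_diagonal]

theorem trace_pow_eq_sum_eigenvalues {A : Matrix κ κ ℂ} (hA : A.IsHermitian) (k : ℕ) :
    (A ^ k).trace = ∑ i, (hA.eigenvalues i : ℂ) ^ k := by
  conv_lhs => rw [hA.spectral_theorem]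
  rw [← map_pow, Unitary.conjStarAlgAut_apply, trace_unitary_conj, Matrix.diagonal_pow,
    Matrix.trace_diagonal]
  rfl

theorem star_dotProduct_diagonal_mulVec (w : κ → ℝ) (z : κ → ℂ) :
    star z ⬝ᵥ (diagonal (fun i => (w i : ℂ)) *ᵥ z) = ((∑ i, w i * ‖z i‖ ^ 2 : ℝ) : ℂ) := by
  rw [dotProduct]
  push_cast
  refine Finset.sum_congr rfl fun i _ => ?_
  rw [mulVec_diagonal, Pi.star_apply, ← Complex.conj_mul', RCLike.star_def]
  ring

theorem sum_mul_norm_sq_mulVec (G : Matrix κ' κ ℂ) (w' : κ' → ℝ) (w : κ → ℝ)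
    (h : Gᴴ * diagonal (fun i => (w' i : ℂ)) * G = diagonal (fun i => (w i : ℂ))) (y : κ → ℂ) :
    ∑ i, w' i * ‖(G *ᵥ y) i‖ ^ 2 = ∑ j, w j * ‖y j‖ ^ 2 := by
  have h1 := star_dotProduct_diagonal_mulVec w' (G *ᵥ y)
  rw [star_mulVec, ← dotProduct_mulVec, mulVec_mulVec, mulVec_mulVec, h,
    star_dotProduct_diagonal_mulVec] at h1
  exact_mod_cast h1.symm

/-- Half of Cauchy interlacing: the compression `Vᴴ A V` to a subspace has no more eigenvalues than
`A` in any closed lower, or open upper, half-line. The coordinates, in an eigenbasis of `A`, of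
vectors spanned by the eigenvectors of the compression in the half-line are determined by those
belonging to eigenvalues of `A` in the half-line. -/
theorem card_eigenvalues_compression_le {A : Matrix κ' κ' ℂ} (hA : A.IsHermitian)
    {B : Matrix κ κ ℂ} (hB : B.IsHermitian) {V : Matrix κ' κ ℂ} (hV : Vᴴ * V = 1)
    (hVB : Vᴴ * A * V = B) {t : ℝ} (S : Set ℝ) (hS : S = Set.Iic t ∨ S = Set.Ioi t)
    [DecidablePred (· ∈ S)] :
    (Finset.univ.filter fun j => hB.eigenvalues j ∈ S).card ≤
      (Finset.univ.filter fun i => hA.eigenvalues i ∈ S).card := by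
  set UA := (hA.eigenvectorUnitary : Matrix κ' κ' ℂ) with hUA
  set UB := (hB.eigenvectorUnitary : Matrix κ κ ℂ) with hUB
  have hUA1 : UA * UAᴴ = 1 := Unitary.coe_mul_star_self _
  have hUB1 : UBᴴ * UB = 1 := Unitary.coe_star_mul_self _
  have hDA : UA * diagonal (fun i => (hA.eigenvalues i : ℂ)) * UAᴴ = A := by
    conv_rhs => rw [hA.spectral_theorem]
    rw [Unitary.conjStarAlgAut_apply]
    rfl
  have hDB : UBᴴ * B * UB = diagonal (fun i => (hB.eigenvalues i : ℂ)) := by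
    have h := hB.conjStarAlgAut_star_eigenvectorUnitary
    rw [Unitary.conjStarAlgAut_star_apply] at h
    exact h
  set G : Matrix κ' κ ℂ := UAᴴ * V * UB with hG
  have hGH : Gᴴ = UBᴴ * Vᴴ * UA := by
    rw [hG, conjTranspose_mul, conjTranspose_mul, conjTranspose_conjTranspose, Matrix.mul_assoc]
  have hG1 : Gᴴ * diagonal (fun _ : κ' => ((1 : ℝ) : ℂ)) * G =
      diagonal (fun _ : κ => ((1 : ℝ) : ℂ)) := by
    calc Gᴴ * diagonal (fun _ : κ' => ((1 : ℝ) : ℂ)) * G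
        = UBᴴ * (Vᴴ * (UA * UAᴴ) * V) * UB := by
          rw [hGH, hG]
          simp only [Complex.ofReal_one, diagonal_one, Matrix.mul_assoc, Matrix.mul_one]
      _ = _ := by
          rw [hUA1, Matrix.mul_one, hV, Matrix.mul_one, hUB1]
          simp
  have hG2 : Gᴴ * diagonal (fun i => (hA.eigenvalues i : ℂ)) * G =
      diagonal (fun i => (hB.eigenvalues i : ℂ)) := by
    have h1 : Gᴴ * diagonal (fun i => (hA.eigenvalues i : ℂ)) * G =
        UBᴴ * (Vᴴ * (UA * diagonal (fun i => (hA.eigenvalues i : ℂ)) * UAᴴ) * V) * UB := by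
      rw [hGH, hG]
      simp only [Matrix.mul_assoc]
    rw [h1, hDA, hVB, hDB]
  let L : ({j // hB.eigenvalues j ∈ S} → ℂ) →ₗ[ℂ] ({i // hA.eigenvalues i ∈ S} → ℂ) :=
    LinearMap.funLeft ℂ ℂ Subtype.val ∘ₗ G.mulVecLin ∘ₗ
      Function.ExtendByZero.linearMap ℂ Subtype.val
  have hL : Function.Injective L := by
    rw [← LinearMap.ker_eq_bot, LinearMap.ker_eq_bot']
    intro y hy
    set x : κ → ℂ := Function.extend Subtype.val y 0 with hx
    have hx0 : ∀ j, hB.eigenvalues j ∉ S → x j = 0 := fun j hj => by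
      rw [hx, Function.extend_apply']
      · rfl
      · rintro ⟨a, rfl⟩
        exact hj a.2
    have hz0 : ∀ i, hA.eigenvalues i ∈ S → (G *ᵥ x) i = 0 := fun i hi => congrFun hy ⟨i, hi⟩
    have e1 := sum_mul_norm_sq_mulVec G _ _ hG1 x
    have e2 := sum_mul_norm_sq_mulVec G _ _ hG2 x
    have e3 : ∑ i, (hA.eigenvalues i - t) * ‖(G *ᵥ x) i‖ ^ 2 =
        ∑ j, (hB.eigenvalues j - t) * ‖x j‖ ^ 2 := by
      simp only [sub_mul, Finset.sum_sub_distrib, e2, ← Finset.mul_sum]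
      simp only [one_mul] at e1
      rw [e1]
    have hxz : x = 0 := by
      rcases hS with rfl | rfl
      · have h1 : ∀ i ∈ Finset.univ, 0 ≤ (hA.eigenvalues i - t) * ‖(G *ᵥ x) i‖ ^ 2 := by
          intro i _
          by_cases hi : hA.eigenvalues i ∈ Set.Iic t
          · simp [hz0 i hi]
          · have : t < hA.eigenvalues i := by simpa using hi
            exact mul_nonneg (by linarith) (by positivity)
        have h2 : ∑ j, (hB.eigenvalues j - t) * ‖x j‖ ^ 2 ≤ 0 := by
          refine Finset.sum_nonpos fun j _ => ?_
          by_cases hj : hB.eigenvalues j ∈ Set.Iic t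
          · have : hB.eigenvalues j ≤ t := hj
            exact mul_nonpos_of_nonpos_of_nonneg (by linarith) (by positivity)
          · simp [hx0 j hj]
        have h3 := (Finset.sum_eq_zero_iff_of_nonneg h1).1
          (le_antisymm (e3.le.trans h2) (Finset.sum_nonneg h1))
        have h4 : ∀ i, (G *ᵥ x) i = 0 := by
          intro i
          by_cases hi : hA.eigenvalues i ∈ Set.Iic t
          · exact hz0 i hi
          · have h5 : t < hA.eigenvalues i := by simpa using hi
            simpa [sub_ne_zero.2 h5.ne'] using h3 i (Finset.mem_univ i)
        have h6 : ∑ j, ‖x j‖ ^ 2 = 0 := by simpa [h4] using e1.symm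
        ext j
        simpa using (Finset.sum_eq_zero_iff_of_nonneg fun j _ => by positivity).1 h6 j
          (Finset.mem_univ j)
      · have h1 : ∀ j ∈ Finset.univ, 0 ≤ (hB.eigenvalues j - t) * ‖x j‖ ^ 2 := by
          intro j _
          by_cases hj : hB.eigenvalues j ∈ Set.Ioi t
          · have : t < hB.eigenvalues j := hj
            exact mul_nonneg (by linarith) (by positivity)
          · simp [hx0 j hj]
        have h2 : ∑ i, (hA.eigenvalues i - t) * ‖(G *ᵥ x) i‖ ^ 2 ≤ 0 := by
          refine Finset.sum_nonpos fun i _ => ?_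
          by_cases hi : hA.eigenvalues i ∈ Set.Ioi t
          · simp [hz0 i hi]
          · have : hA.eigenvalues i ≤ t := by simpa using hi
            exact mul_nonpos_of_nonpos_of_nonneg (by linarith) (by positivity)
        have h3 := (Finset.sum_eq_zero_iff_of_nonneg h1).1
          (le_antisymm (e3.ge.trans h2) (Finset.sum_nonneg h1))
        ext j
        by_cases hj : hB.eigenvalues j ∈ Set.Ioi t
        · have h5 : t < hB.eigenvalues j := hj
          simpa [sub_ne_zero.2 h5.ne'] using h3 j (Finset.mem_univ j)
        · exact hx0 j hj
    ext j
    have := congrFun hxz j.1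
    rwa [hx, Subtype.val_injective.extend_apply] at this
  have h := LinearMap.finrank_le_finrank_of_injective hL
  rwa [Module.finrank_fintype_fun_eq_card, Module.finrank_fintype_fun_eq_card,
    Fintype.card_subtype, Fintype.card_subtype] at h

/-- The number of eigenvalues of a Hermitian matrix that are at most `t`. -/
noncomputable def eigenCount {A : Matrix κ κ ℂ} (hA : A.IsHermitian) (t : ℝ) : ℕ :=
  (Finset.univ.filter fun i => hA.eigenvalues i ≤ t).card

/-- Cauchy interlacing for eigenvalue counting functions. -/
theorem eigenCount_compression {A : Matrix κ' κ' ℂ} (hA : A.IsHermitian)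
    {B : Matrix κ κ ℂ} (hB : B.IsHermitian) {V : Matrix κ' κ ℂ} (hV : Vᴴ * V = 1)
    (hVB : Vᴴ * A * V = B) (t : ℝ) :
    eigenCount hB t ≤ eigenCount hA t ∧
      eigenCount hA t + Fintype.card κ ≤ eigenCount hB t + Fintype.card κ' := by
  classical
  have h1 := card_eigenvalues_compression_le hA hB hV hVB (Set.Iic t) (Or.inl rfl)
  have h2 := card_eigenvalues_compression_le hA hB hV hVB (Set.Ioi t) (Or.inr rfl)
  simp only [Set.mem_Iic, Set.mem_Ioi, ← not_le] at h1 h2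
  have h3 := Finset.card_filter_add_card_filter_not (s := Finset.univ)
    (fun i => hA.eigenvalues i ≤ t)
  have h4 := Finset.card_filter_add_card_filter_not (s := Finset.univ)
    (fun i => hB.eigenvalues i ≤ t)
  rw [Finset.card_univ] at h3 h4
  unfold eigenCount
  omega

theorem mul_eigenCount_eq_sum_indicator {A : Matrix κ κ ℂ} (hA : A.IsHermitian)
    (h : ℝ → ℂ) (t : ℝ) :
    h t * eigenCount hA t = ∑ i, (Set.Ici (hA.eigenvalues i)).indicator h t := by
  simp only [Set.indicator_apply, Set.mem_Ici, eigenCount, ← Finset.sum_filter, Finset.sum_const,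
    nsmul_eq_mul]
  ring

theorem integrableOn_mul_eigenCount {A : Matrix κ κ ℂ} (hA : A.IsHermitian) {h : ℝ → ℂ}
    {s : Set ℝ} (hs : IntegrableOn h s) : IntegrableOn (fun t => h t * eigenCount hA t) s := by
  simp only [mul_eigenCount_eq_sum_indicator]
  exact integrable_finsetSum _ fun i _ => hs.indicator measurableSet_Ici

/-- The sum of `g` over the eigenvalues, in terms of the eigenvalue counting function, for a
primitive `g` of `h` on an interval `[-K, K]` containing the spectrum. -/
theorem sum_eigenvalues_eq_sub_integral {A : Matrix κ κ ℂ} (hA : A.IsHermitian) {K : ℝ}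
    (hK : ∀ i, |hA.eigenvalues i| ≤ K) {g h : ℝ → ℂ}
    (hh : IntervalIntegrable h volume (-K) K)
    (hg : ∀ x, |x| ≤ K → g x = g K - ∫ t in x..K, h t) :
    ∑ i, g (hA.eigenvalues i) =
      Fintype.card κ * g K - ∫ t in Set.Ioc (-K) K, h t * eigenCount hA t := by
  have h1 : ∀ i, ∫ t in (hA.eigenvalues i)..K, h t =
      ∫ t in Set.Ioc (-K) K, (Set.Ici (hA.eigenvalues i)).indicator h t := by
    intro i
    have hi := abs_le.1 (hK i)
    rw [intervalIntegral.integral_of_le hi.2, setIntegral_indicator measurableSet_Ici,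
      ← integral_Icc_eq_integral_Ioc]
    rcases eq_or_lt_of_le hi.1 with he | hlt
    · rw [← he, integral_Icc_eq_integral_Ioc]
      congr 2
      ext t
      simp only [Set.mem_Ioc, Set.mem_inter_iff, Set.mem_Ici]
      constructor
      · rintro ⟨h1, h2⟩
        exact ⟨⟨h1, h2⟩, h1.le⟩
      · rintro ⟨h1, _⟩
        exact h1
    · congr 2
      ext t
      simp only [Set.mem_Icc, Set.mem_inter_iff, Set.mem_Ici, Set.mem_Ioc]
      constructor
      · rintro ⟨h1, h2⟩
        exact ⟨⟨by linarith, h2⟩, h1⟩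
      · rintro ⟨h1, h2⟩
        exact ⟨h2, h1.2⟩
  by_cases hne : Nonempty κ
  · obtain ⟨i₀⟩ := hne
    have hK0 : 0 ≤ K := (abs_nonneg _).trans (hK i₀)
    have hint : IntegrableOn h (Set.Ioc (-K) K) := by
      rwa [intervalIntegrable_iff_integrableOn_Ioc_of_le (by linarith)] at hh
    calc ∑ i, g (hA.eigenvalues i)
        = ∑ i, (g K - ∫ t in Set.Ioc (-K) K, (Set.Ici (hA.eigenvalues i)).indicator h t) :=
          Finset.sum_congr rfl fun i _ => by rw [hg _ (hK i), h1]
      _ = Fintype.card κ * g K - ∫ t in Set.Ioc (-K) K,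
            ∑ i, (Set.Ici (hA.eigenvalues i)).indicator h t := by
          rw [Finset.sum_sub_distrib, integral_finsetSum _
            (fun i _ => hint.indicator measurableSet_Ici)]
          simp
      _ = _ := by
          simp only [mul_eigenCount_eq_sum_indicator]
  · rw [not_nonempty_iff] at hne
    simp [eigenCount]

/-- Passing to a compression changes the sum of `g` over the eigenvalues by at most the codimension
times the variation of `g`, for a function `g` that vanishes at the right end of the interval. -/
theorem norm_sum_eigenvalues_sub_le {A : Matrix κ' κ' ℂ} (hA : A.IsHermitian)
    {B : Matrix κ κ ℂ} (hB : B.IsHermitian) {V : Matrix κ' κ ℂ} (hV : Vᴴ * V = 1)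
    (hVB : Vᴴ * A * V = B) {K : ℝ} (hK0 : 0 ≤ K) (hKA : ∀ i, |hA.eigenvalues i| ≤ K)
    (hKB : ∀ i, |hB.eigenvalues i| ≤ K) {g h : ℝ → ℂ}
    (hh : IntervalIntegrable h volume (-K) K)
    (hg : ∀ x, |x| ≤ K → g x = - ∫ t in x..K, h t) :
    ‖∑ i, g (hA.eigenvalues i) - ∑ j, g (hB.eigenvalues j)‖ ≤
      ((Fintype.card κ' : ℝ) - Fintype.card κ) * ∫ t in (-K)..K, ‖h t‖ := by
  have hgK : g K = 0 := by rw [hg K (abs_of_nonneg hK0).le]; simp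
  have hg' : ∀ x, |x| ≤ K → g x = g K - ∫ t in x..K, h t := fun x hx => by
    rw [hgK, hg x hx, zero_sub]
  have hint : IntegrableOn h (Set.Ioc (-K) K) := by
    rwa [intervalIntegrable_iff_integrableOn_Ioc_of_le (by linarith)] at hh
  have hAi := integrableOn_mul_eigenCount hA hint
  have hBi := integrableOn_mul_eigenCount hB hint
  rw [sum_eigenvalues_eq_sub_integral hA hKA hh hg', sum_eigenvalues_eq_sub_integral hB hKB hh hg',
    hgK, mul_zero, mul_zero, zero_sub, zero_sub, sub_neg_eq_add, neg_add_eq_sub,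
    ← integral_sub hBi hAi, intervalIntegral.integral_of_le (by linarith),
    ← integral_const_mul]
  refine norm_integral_le_of_norm_le (hint.norm.const_mul _) (ae_of_all _ fun t => ?_)
  obtain ⟨h1, h2⟩ := eigenCount_compression hA hB hV hVB t
  have h1' : (eigenCount hB t : ℝ) ≤ eigenCount hA t := by exact_mod_cast h1
  have h2' : (eigenCount hA t : ℝ) + Fintype.card κ ≤ eigenCount hB t + Fintype.card κ' := by
    exact_mod_cast h2
  have h3 : ‖(eigenCount hB t : ℂ) - eigenCount hA t‖ =
      (eigenCount hA t : ℝ) - eigenCount hB t := by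
    rw [norm_sub_rev, ← abs_of_nonneg (sub_nonneg.2 h1'), ← Real.norm_eq_abs, ← Complex.norm_real]
    push_cast
    rfl
  rw [← mul_sub, norm_mul, h3, mul_comm]
  exact mul_le_mul_of_nonneg_right (by linarith) (norm_nonneg _)

theorem abs_eigenvalue_le_of_inner {ι H : Type*} [NormedAddCommGroup H] [InnerProductSpace ℂ H]
    (v : ι → H) (hv : Orthonormal ℂ v) (M : H →L[ℂ] H) (φ : κ → ι) (hφ : Function.Injective φ)
    {A : Matrix κ κ ℂ} (hA : A.IsHermitian) (hM : ∀ p q, A p q = ⟪v (φ p), M (v (φ q))⟫_ℂ)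
    (i : κ) : |hA.eigenvalues i| ≤ ‖M‖ := by
  set y : κ → ℂ := ⇑(hA.eigenvectorBasis i) with hy
  set x : H := ∑ p, y p • v (φ p) with hx
  have hxn : ‖x‖ = 1 := by
    have h1 : ⟪x, x⟫_ℂ = 1 := by
      have h0 := (hv.comp φ hφ).inner_sum y y Finset.univ
      simp only [Function.comp_apply] at h0
      rw [hx, h0]
      have := orthonormal_iff_ite.1 hA.eigenvectorBasis.orthonormal i i
      rw [PiLp.inner_apply] at this
      simpa [hy, Complex.conj_mul'] using this
    rw [inner_self_eq_norm_sq_to_K] at h1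
    have h2 : ‖x‖ ^ 2 = 1 := Complex.ofReal_injective (by push_cast; exact h1)
    nlinarith [norm_nonneg x]
  have h1 : star y ⬝ᵥ (A *ᵥ y) = ⟪x, M x⟫_ℂ := by
    simp only [hx, map_sum, map_smul, sum_inner, inner_sum, inner_smul_left, inner_smul_right,
      dotProduct, mulVec, hM, Finset.mul_sum, Pi.star_apply, RCLike.star_def]
    rw [Finset.sum_comm]
    refine Finset.sum_congr rfl fun p _ => Finset.sum_congr rfl fun q _ => ?_
    ring
  rw [hA.eigenvalues_eq i, ← hy, h1]
  refine (RCLike.abs_re_le_norm _).trans ((norm_inner_le_norm _ _).trans ?_)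
  have := M.le_opNorm x
  rw [hxn] at this ⊢
  linarith

/-- The sum of the squares of the eigenvalues is the squared Hilbert–Schmidt norm, which bounds each
of them. -/
theorem abs_eigenvalue_le_of_norm_le {A : Matrix κ κ ℂ} (hA : A.IsHermitian) {C : ℝ}
    (hC0 : 0 ≤ C) (hC : ∀ p q, ‖A p q‖ ≤ C) (i : κ) :
    |hA.eigenvalues i| ≤ Fintype.card κ * C := by
  have h1 := trace_pow_eq_sum_eigenvalues hA 2
  have h2 : ‖(A ^ 2).trace‖ ≤ (Fintype.card κ * C) ^ 2 := by
    rw [pow_two, Matrix.trace]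
    calc ‖∑ p, (A * A).diag p‖ ≤ ∑ p : κ, ∑ q : κ, C * C := by
          refine norm_sum_le_of_le _ fun p _ => ?_
          rw [Matrix.diag_apply, Matrix.mul_apply]
          refine norm_sum_le_of_le _ fun q _ => ?_
          rw [norm_mul]
          exact mul_le_mul (hC _ _) (hC _ _) (norm_nonneg _) hC0
      _ = _ := by
          simp
          ring
  have h3 : ‖(A ^ 2).trace‖ = ∑ j, hA.eigenvalues j ^ 2 := by
    rw [h1]
    have : ∑ j, (hA.eigenvalues j : ℂ) ^ 2 = ((∑ j, hA.eigenvalues j ^ 2 : ℝ) : ℂ) := by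
      push_cast
      rfl
    rw [this, Complex.norm_real, Real.norm_eq_abs, abs_of_nonneg]
    positivity
  have h4 : hA.eigenvalues i ^ 2 ≤ ∑ j, hA.eigenvalues j ^ 2 :=
    Finset.single_le_sum (f := fun j => hA.eigenvalues j ^ 2) (fun j _ => sq_nonneg _)
      (Finset.mem_univ i)
  exact abs_le_of_sq_le_sq (by linarith) (by positivity)

end Eigenvalues

/-! ### Polynomial approximation of absolutely continuous functions -/

section Approximation

open Polynomial

theorem absolutelyContinuousOnInterval_of_dist_le {X Y : Type*} [PseudoMetricSpace X]
    [PseudoMetricSpace Y] {f : ℝ → X} {g : ℝ → Y} {a b : ℝ}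
    (hf : AbsolutelyContinuousOnInterval f a b) (h : ∀ x y, dist (g x) (g y) ≤ dist (f x) (f y)) :
    AbsolutelyContinuousOnInterval g a b := by
  rw [absolutelyContinuousOnInterval_iff] at hf ⊢
  intro ε hε
  obtain ⟨δ, hδ, H⟩ := hf ε hε
  exact ⟨δ, hδ, fun E hE hlt => (Finset.sum_le_sum fun i _ => h _ _).trans_lt (H E hE hlt)⟩

/-- The fundamental theorem of calculus for complex-valued absolutely continuous functions. -/
theorem exists_eq_sub_integral (f : ℝ → ℂ) (hf : ∀ a b : ℝ, AbsolutelyContinuousOnInterval f a b)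
    (K : ℝ) : ∃ h : ℝ → ℂ, (∀ a b, IntervalIntegrable h volume a b) ∧
      ∀ x, f x = f K - ∫ t in x..K, h t := by
  have hre : ∀ a b, AbsolutelyContinuousOnInterval (fun x => (f x).re) a b := fun a b =>
    absolutelyContinuousOnInterval_of_dist_le (hf a b) fun x y => by
      rw [Real.dist_eq, Complex.dist_eq, ← Complex.sub_re]
      exact Complex.abs_re_le_norm _
  have him : ∀ a b, AbsolutelyContinuousOnInterval (fun x => (f x).im) a b := fun a b =>
    absolutelyContinuousOnInterval_of_dist_le (hf a b) fun x y => by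
      rw [Real.dist_eq, Complex.dist_eq, ← Complex.sub_im]
      exact Complex.abs_im_le_norm _
  have h1 : ∀ a b,
      IntervalIntegrable (fun t => ((deriv (fun x => (f x).re) t : ℝ) : ℂ)) volume a b :=
    fun a b => ⟨(hre a b).intervalIntegrable_deriv.1.ofReal,
      (hre a b).intervalIntegrable_deriv.2.ofReal⟩
  have h2 : ∀ a b,
      IntervalIntegrable (fun t => ((deriv (fun x => (f x).im) t : ℝ) : ℂ)) volume a b :=
    fun a b => ⟨(him a b).intervalIntegrable_deriv.1.ofReal,
      (him a b).intervalIntegrable_deriv.2.ofReal⟩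
  refine ⟨fun t => ((deriv (fun x => (f x).re) t : ℝ) : ℂ) +
    ((deriv (fun x => (f x).im) t : ℝ) : ℂ) * Complex.I,
    fun a b => (h1 a b).add ((h2 a b).mul_const _), fun x => ?_⟩
  rw [intervalIntegral.integral_add (h1 x K) ((h2 x K).mul_const _),
    intervalIntegral.integral_mul_const, intervalIntegral.integral_ofReal,
    intervalIntegral.integral_ofReal, (hre x K).integral_deriv_eq_sub,
    (him x K).integral_deriv_eq_sub]
  apply Complex.ext <;> simp

theorem exists_polynomial_derivative_eq (q : ℂ[X]) : ∃ p : ℂ[X], derivative p = q := by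
  induction q using Polynomial.induction_on' with
  | add p q hp hq =>
    obtain ⟨p', rfl⟩ := hp
    obtain ⟨q', rfl⟩ := hq
    exact ⟨p' + q', derivative_add⟩
  | monomial n a =>
    refine ⟨monomial (n + 1) (a / (n + 1)), ?_⟩
    have : (n : ℂ) + 1 ≠ 0 := by exact_mod_cast Nat.succ_ne_zero n
    rw [derivative_monomial]
    push_cast
    rw [div_mul_cancel₀ _ this]

theorem exists_complex_polynomial_near (c : ℝ → ℂ) (hc : Continuous c) (a b : ℝ) {ε : ℝ}
    (hε : 0 < ε) : ∃ q : ℂ[X], ∀ x ∈ Set.Icc a b, ‖c x - q.eval (x : ℂ)‖ ≤ ε := by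
  obtain ⟨q₁, h1⟩ := exists_polynomial_near_of_continuousOn a b (fun x => (c x).re)
    (Complex.continuous_re.comp hc).continuousOn (ε / 2) (by positivity)
  obtain ⟨q₂, h2⟩ := exists_polynomial_near_of_continuousOn a b (fun x => (c x).im)
    (Complex.continuous_im.comp hc).continuousOn (ε / 2) (by positivity)
  refine ⟨q₁.map Complex.ofRealHom + C Complex.I * q₂.map Complex.ofRealHom, fun x hx => ?_⟩
  have e : ∀ q : ℝ[X], (q.map Complex.ofRealHom).eval (x : ℂ) = ((q.eval x : ℝ) : ℂ) := fun q => by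
    rw [eval_map, ← Complex.ofRealHom_eq_coe, eval₂_at_apply]
    rfl
  refine (Complex.norm_le_abs_re_add_abs_im _).trans ?_
  have h1' := h1 x hx
  have h2' := h2 x hx
  rw [abs_sub_comm] at h1' h2'
  simp only [eval_add, eval_mul, eval_C, e, Complex.sub_re, Complex.sub_im, Complex.add_re,
    Complex.add_im, Complex.mul_re, Complex.mul_im, Complex.I_re, Complex.I_im, Complex.ofReal_re,
    Complex.ofReal_im, zero_mul, one_mul, mul_zero, sub_zero, zero_add, add_zero]
  linarith

/-- An absolutely continuous function is approximated in variation, on a compact interval, by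
polynomials with the same value at the right end: its derivative is approximated in `L¹`. -/
theorem exists_polynomial_near_of_absolutelyContinuous (f : ℝ → ℂ)
    (hf : ∀ a b : ℝ, AbsolutelyContinuousOnInterval f a b) {K : ℝ} (hK : 0 ≤ K) {ε : ℝ}
    (hε : 0 < ε) :
    ∃ (p : ℂ[X]) (h : ℝ → ℂ), IntervalIntegrable h volume (-K) K ∧
      (∫ t in (-K)..K, ‖h t‖) ≤ ε ∧
      ∀ x : ℝ, f x - p.eval (x : ℂ) = -∫ t in x..K, h t := by
  obtain ⟨h₀, hh₀, hf₀⟩ := exists_eq_sub_integral f hf K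
  have hint : IntegrableOn h₀ (Set.Ioc (-K) K) :=
    (intervalIntegrable_iff_integrableOn_Ioc_of_le (by linarith)).1 (hh₀ _ _)
  obtain ⟨c, -, hc, hcc, hci⟩ := hint.exists_hasCompactSupport_integral_sub_le
    (half_pos hε)
  obtain ⟨q, hq⟩ := exists_complex_polynomial_near c hcc (-K) K
    (ε := ε / 2 / (2 * K + 1)) (by positivity)
  obtain ⟨p₀, hp₀⟩ := exists_polynomial_derivative_eq q
  have hqc : Continuous fun t : ℝ => q.eval (t : ℂ) := q.continuous.comp Complex.continuous_ofReal
  have hqi : ∀ a b, IntervalIntegrable (fun t : ℝ => q.eval (t : ℂ)) volume a b :=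
    fun a b => hqc.intervalIntegrable a b
  refine ⟨p₀ + C (f K - p₀.eval (K : ℂ)), fun t => h₀ t - q.eval (t : ℂ), (hh₀ _ _).sub (hqi _ _),
    ?_, fun x => ?_⟩
  · rw [intervalIntegral.integral_of_le (by linarith)]
    have hqint : IntegrableOn (fun t : ℝ => q.eval (t : ℂ)) (Set.Ioc (-K) K) :=
      (intervalIntegrable_iff_integrableOn_Ioc_of_le (by linarith)).1 (hqi _ _)
    have h1 : ∫ t in Set.Ioc (-K) K, ‖c t - q.eval (t : ℂ)‖ ≤ ε / 2 := by
      have h2 : ∫ t in Set.Ioc (-K) K, ‖c t - q.eval (t : ℂ)‖ ≤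
          ∫ t in Set.Ioc (-K) K, ε / 2 / (2 * K + 1) :=
        setIntegral_mono_on (hci.sub hqint).norm (integrable_const _) measurableSet_Ioc
          fun t ht => hq t (Set.Ioc_subset_Icc_self ht)
      refine h2.trans ?_
      rw [setIntegral_const, measureReal_def, Real.volume_Ioc, ENNReal.toReal_ofReal (by linarith),
        smul_eq_mul, mul_div_assoc', div_le_iff₀ (by linarith)]
      nlinarith
    calc ∫ t in Set.Ioc (-K) K, ‖h₀ t - q.eval (t : ℂ)‖
        ≤ ∫ t in Set.Ioc (-K) K, (‖h₀ t - c t‖ + ‖c t - q.eval (t : ℂ)‖) :=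
          integral_mono (hint.sub hqint).norm ((hint.sub hci).norm.add (hci.sub hqint).norm)
            fun t => norm_sub_le_norm_sub_add_norm_sub _ _ _
      _ = (∫ t in Set.Ioc (-K) K, ‖h₀ t - c t‖) + ∫ t in Set.Ioc (-K) K, ‖c t - q.eval (t : ℂ)‖ :=
          integral_add (hint.sub hci).norm (hci.sub hqint).norm
      _ ≤ ε := by linarith
  · have h1 : ∫ t in x..K, q.eval (t : ℂ) = p₀.eval (K : ℂ) - p₀.eval (x : ℂ) := by
      refine intervalIntegral.integral_eq_sub_of_hasDerivAt (f := fun t : ℝ => p₀.eval (t : ℂ))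
        (fun t _ => ?_) (hqi x K)
      rw [← hp₀]
      exact (p₀.hasDerivAt (t : ℂ)).comp_ofReal
    rw [intervalIntegral.integral_sub (hh₀ _ _) (hqi _ _), h1, hf₀ x, eval_add, eval_C]
    ring

theorem norm_le_of_eq_neg_integral {g h : ℝ → ℂ} {K ε : ℝ}
    (hh : IntervalIntegrable h volume (-K) K) (hε : (∫ t in (-K)..K, ‖h t‖) ≤ ε) {x : ℝ}
    (hg : g x = -∫ t in x..K, h t) (hx : |x| ≤ K) : ‖g x‖ ≤ ε := by
  have hx' := abs_le.1 hx
  rw [hg, norm_neg]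
  refine (intervalIntegral.norm_integral_le_integral_norm hx'.2).trans (le_trans ?_ hε)
  refine intervalIntegral.integral_mono_interval hx'.1 hx'.2 le_rfl ?_ hh.norm
  exact ae_of_all _ fun t => norm_nonneg _

end Approximation

/-! ### The limit of the increments -/

section Limit

open Polynomial

variable {d : ℕ}

theorem trace_hermitianFun_polynomial {κ : Type*} [Fintype κ] [DecidableEq κ] {A : Matrix κ κ ℂ}
    (hA : A.IsHermitian) (p : ℂ[X]) :
    (hermitianFun (fun x => p.eval (x : ℂ)) A).trace =
      ∑ k ∈ Finset.range (p.natDegree + 1), p.coeff k * (A ^ k).trace := by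
  rw [trace_hermitianFun hA]
  simp only [eval_eq_sum_range, trace_pow_eq_sum_eigenvalues hA, Finset.mul_sum]
  rw [Finset.sum_comm]

theorem memLp_top_matrix_pow {α : Type*} [MeasurableSpace α] {μ : Measure α} [IsFiniteMeasure μ]
    {T : α → Matrix (Fin d) (Fin d) ℂ} (hT : ∀ a b, MemLp (fun θ => T θ a b) ⊤ μ) (k : ℕ)
    (a b : Fin d) : MemLp (fun θ => (T θ ^ k) a b) ⊤ μ := by
  induction k generalizing a with
  | zero => simpa only [pow_zero] using memLp_const _
  | succ k ih =>
    simp only [pow_succ', Matrix.mul_apply]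
    exact memLp_finsetSum _ fun c _ => (ih c).mul' (hT a c)

theorem exists_norm_entry_le {α : Type*} [MeasurableSpace α] {μ : Measure α}
    {T : α → Matrix (Fin d) (Fin d) ℂ} (hT : ∀ a b, MemLp (fun θ => T θ a b) ⊤ μ) :
    ∃ C : ℝ, 0 ≤ C ∧ ∀ᵐ θ ∂μ, ∀ a b, ‖T θ a b‖ ≤ C := by
  refine ⟨∑ a, ∑ b, lpNorm (fun θ => T θ a b) ⊤ μ,
    Finset.sum_nonneg fun a _ => Finset.sum_nonneg fun b _ => lpNorm_nonneg, ?_⟩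
  have h : ∀ a b, ∀ᵐ θ ∂μ, ‖T θ a b‖ ≤ lpNorm (fun θ => T θ a b) ⊤ μ := fun a b =>
    ae_le_lpNorm_exponent_top (hT a b)
  filter_upwards [ae_all_iff.2 fun a => ae_all_iff.2 (h a)] with θ hθ a b
  refine (hθ a b).trans ?_
  refine le_trans ?_ (Finset.single_le_sum (f := fun a => ∑ b, lpNorm (fun θ => T θ a b) ⊤ μ)
    (fun a _ => Finset.sum_nonneg fun b _ => lpNorm_nonneg) (Finset.mem_univ a))
  exact Finset.single_le_sum (f := fun b => lpNorm (fun θ => T θ a b) ⊤ μ)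
    (fun b _ => lpNorm_nonneg) (Finset.mem_univ b)

theorem truncation_eq_compression (X : Matrix (ℕ × Fin d) (ℕ × Fin d) ℂ) (n : ℕ) :
    ∃ V : Matrix (Fin (n + 1) × Fin d) (Fin n × Fin d) ℂ, V.conjTranspose * V = 1 ∧
      V.conjTranspose * truncation X (n + 1) * V = truncation X n := by
  let φ : Fin n × Fin d → Fin (n + 1) × Fin d := Prod.map Fin.castSucc id
  have hφ : Function.Injective φ := (Fin.castSucc_injective n).prodMap Function.injective_id
  refine ⟨(1 : Matrix _ _ ℂ).submatrix id φ, ?_, ?_⟩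
  · ext p q
    simp [Matrix.mul_apply, Matrix.one_apply, hφ.eq_iff]
  · ext p q
    simp [Matrix.mul_apply, Matrix.one_apply, truncation, φ]
    rfl

theorem integrable_trace_pow {α : Type*} [MeasurableSpace α] {μ : Measure α} [IsFiniteMeasure μ]
    {T : α → Matrix (Fin d) (Fin d) ℂ} (hT : ∀ a b, MemLp (fun θ => T θ a b) ⊤ μ) (k : ℕ) :
    Integrable (fun θ => (T θ ^ k).trace) μ :=
  integrable_finsetSum _ fun a _ => (memLp_top_matrix_pow hT k a a).integrable le_top

theorem integrable_trace_polynomial {α : Type*} [MeasurableSpace α] {μ : Measure α}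
    [IsFiniteMeasure μ] {T : α → Matrix (Fin d) (Fin d) ℂ}
    (hT : ∀ a b, MemLp (fun θ => T θ a b) ⊤ μ) (hH : ∀ᵐ θ ∂μ, (T θ).IsHermitian) (p : ℂ[X]) :
    Integrable (fun θ => (hermitianFun (fun x => p.eval (x : ℂ)) (T θ)).trace) μ := by
  have h : Integrable (fun θ => ∑ k ∈ Finset.range (p.natDegree + 1),
      p.coeff k * (T θ ^ k).trace) μ :=
    integrable_finsetSum _ fun k _ => (integrable_trace_pow hT k).const_mul _
  refine h.congr ?_
  filter_upwards [hH] with θ hθ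
  rw [trace_hermitianFun_polynomial hθ]

theorem integral_trace_polynomial {α : Type*} [MeasurableSpace α] {μ : Measure α}
    [IsFiniteMeasure μ] {T : α → Matrix (Fin d) (Fin d) ℂ}
    (hT : ∀ a b, MemLp (fun θ => T θ a b) ⊤ μ) (hH : ∀ᵐ θ ∂μ, (T θ).IsHermitian) (p : ℂ[X]) :
    ∫ θ, (hermitianFun (fun x => p.eval (x : ℂ)) (T θ)).trace ∂μ =
      ∑ k ∈ Finset.range (p.natDegree + 1), p.coeff k * ∑ a, ∫ θ, (T θ ^ k) a a ∂μ := by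
  have h : (fun θ => (hermitianFun (fun x => p.eval (x : ℂ)) (T θ)).trace) =ᵐ[μ]
      fun θ => ∑ k ∈ Finset.range (p.natDegree + 1), p.coeff k * (T θ ^ k).trace := by
    filter_upwards [hH] with θ hθ
    rw [trace_hermitianFun_polynomial hθ]
  rw [integral_congr_ae h,
    integral_finsetSum _ fun k _ => (integrable_trace_pow hT k).const_mul _]
  refine Finset.sum_congr rfl fun k _ => ?_
  rw [integral_const_mul]
  congr 1
  exact integral_finsetSum _ fun a _ => (memLp_top_matrix_pow hT k a a).integrable le_top

/-- A function that is uniformly close to `p` on an interval containing the spectrum has a close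
trace. -/
theorem norm_trace_hermitianFun_sub_le {κ : Type*} [Fintype κ] [DecidableEq κ] {A : Matrix κ κ ℂ}
    (hA : A.IsHermitian) {f g : ℝ → ℂ} {K ε : ℝ} (hK : ∀ i, |hA.eigenvalues i| ≤ K)
    (hfg : ∀ x, |x| ≤ K → ‖f x - g x‖ ≤ ε) :
    ‖(hermitianFun f A).trace - (hermitianFun g A).trace‖ ≤ Fintype.card κ * ε := by
  rw [trace_hermitianFun hA, trace_hermitianFun hA, ← Finset.sum_sub_distrib]
  refine (norm_sum_le_of_le _ fun i _ => hfg _ (hK i)).trans ?_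
  simp

theorem integrable_trace_hermitianFun {α : Type*} [MeasurableSpace α] {μ : Measure α}
    [IsFiniteMeasure μ] {T : α → Matrix (Fin d) (Fin d) ℂ}
    (hT : ∀ a b, MemLp (fun θ => T θ a b) ⊤ μ) {K : ℝ} (hK0 : 0 ≤ K)
    (hK : ∀ᵐ θ ∂μ, ∃ h : (T θ).IsHermitian, ∀ i, |h.eigenvalues i| ≤ K) (f : ℝ → ℂ)
    (hf : ∀ a b : ℝ, AbsolutelyContinuousOnInterval f a b) :
    Integrable (fun θ => (hermitianFun f (T θ)).trace) μ := by
  have hH : ∀ᵐ θ ∂μ, (T θ).IsHermitian := hK.mono fun θ h => h.1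
  have happ : ∀ n : ℕ, ∃ p : ℂ[X], ∀ x, |x| ≤ K → ‖f x - p.eval (x : ℂ)‖ ≤ 1 / ((n : ℝ) + 1) := by
    intro n
    obtain ⟨p, h, h1, h2, h3⟩ := exists_polynomial_near_of_absolutelyContinuous f hf hK0
      (ε := 1 / ((n : ℝ) + 1)) (by positivity)
    exact ⟨p, fun x hx => norm_le_of_eq_neg_integral (g := fun x => f x - p.eval (x : ℂ))
      h1 h2 (h3 x) hx⟩
  choose p hp using happ
  have hbound : ∀ n : ℕ, ∀ᵐ θ ∂μ, ‖(hermitianFun f (T θ)).trace -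
      (hermitianFun (fun x => (p n).eval (x : ℂ)) (T θ)).trace‖ ≤ d * (1 / ((n : ℝ) + 1)) := by
    intro n
    filter_upwards [hK] with θ hθ
    obtain ⟨hA, hθ⟩ := hθ
    simpa using norm_trace_hermitianFun_sub_le hA hθ (hp n)
  have hmeas : AEStronglyMeasurable (fun θ => (hermitianFun f (T θ)).trace) μ := by
    refine aestronglyMeasurable_of_tendsto_ae atTop
      (fun n => (integrable_trace_polynomial hT hH (p n)).aestronglyMeasurable) ?_
    filter_upwards [ae_all_iff.2 hbound] with θ hθ
    have h0 : Tendsto (fun n : ℕ => (d : ℝ) * (1 / ((n : ℝ) + 1))) atTop (𝓝 0) := by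
      simpa using tendsto_one_div_add_atTop_nhds_zero_nat.const_mul (d : ℝ)
    rw [tendsto_iff_norm_sub_tendsto_zero]
    refine squeeze_zero (fun n => norm_nonneg _) (fun n => ?_) h0
    rw [norm_sub_rev]
    exact hθ n
  have hint0 := integrable_trace_polynomial hT hH (p 0)
  have hdiff := Integrable.mono' (integrable_const _) (hmeas.sub hint0.aestronglyMeasurable)
    (hbound 0)
  simpa using hdiff.add hint0

end Limit

end BlockToeplitz

theorem mainTheorem1 (d : ℕ) (T : ℝ → Matrix (Fin d) (Fin d) ℂ)
    (hT : ∀ θ ∈ Set.Ico (-Real.pi) Real.pi, (T θ).IsHermitian)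
    (hTbdd : ∀ a b : Fin d,
      MemLp (fun θ => T θ a b) ⊤ (volume.restrict (Set.Ico (-Real.pi) Real.pi)))
    (f : ℝ → ℂ) (hf : ∀ a b : ℝ, AbsolutelyContinuousOnInterval f a b) :
    IntervalIntegrable (fun θ => (BlockToeplitz.hermitianFun f (T θ)).trace) volume
        (-Real.pi) Real.pi ∧
    Tendsto
      (fun n : ℕ =>
        (BlockToeplitz.hermitianFun f
          (BlockToeplitz.truncation (BlockToeplitz.blockToeplitz T) (n + 1))).trace -
        (BlockToeplitz.hermitianFun f
          (BlockToeplitz.truncation (BlockToeplitz.blockToeplitz T) n)).trace)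
      atTop
      (𝓝 (1 / (2 * (Real.pi : ℂ)) *
        ∫ θ in (-Real.pi)..Real.pi, (BlockToeplitz.hermitianFun f (T θ)).trace)) := by
  open BlockToeplitz in
  have hpi : -Real.pi ≤ Real.pi := by linarith [Real.pi_pos]
  set μ : Measure ℝ := volume.restrict (Set.Ico (-Real.pi) Real.pi) with hμ
  have hμI : ∀ g : ℝ → ℂ, ∫ θ in (-Real.pi)..Real.pi, g θ = ∫ θ, g θ ∂μ := fun g => by
    rw [intervalIntegral.integral_of_le hpi, hμ, integral_Ico_eq_integral_Ioc]
  have hμu : μ.real Set.univ = 2 * Real.pi := by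
    rw [hμ, measureReal_restrict_apply_univ, measureReal_def, Real.volume_Ico,
      ENNReal.toReal_ofReal (by linarith)]
    ring
  have hH : ∀ᵐ θ ∂μ, (T θ).IsHermitian := by
    filter_upwards [ae_restrict_mem measurableSet_Ico] with θ hθ using hT θ hθ
  obtain ⟨H, _, _, _, b, M, hM, hMk⟩ := exists_laurent_operator T hTbdd
  obtain ⟨C, hC0, hC⟩ := exists_norm_entry_le hTbdd
  -- A bound for the spectra of the truncations and for those of almost all values of the symbol.
  set K : ℝ := max ‖M‖ (d * C) with hK
  have hK0 : 0 ≤ K := (norm_nonneg M).trans (le_max_left _ _)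
  have hKT : ∀ᵐ θ ∂μ, ∃ h : (T θ).IsHermitian, ∀ i, |h.eigenvalues i| ≤ K := by
    filter_upwards [hH, hC] with θ h1 h2
    refine ⟨h1, fun i => le_trans ?_ (le_max_right _ _)⟩
    simpa using abs_eigenvalue_le_of_norm_le h1 hC0 h2 i
  have hA : ∀ n, (truncation (blockToeplitz T) n).IsHermitian :=
    truncation_blockToeplitz_isHermitian T hT
  have hKA : ∀ n i, |(hA n).eigenvalues i| ≤ K := by
    intro n i
    refine le_trans (abs_eigenvalue_le_of_inner b b.orthonormal M
      (fun p : Fin n × Fin d => (((p.1 : ℕ) : ℤ), p.2)) ?_ (hA n) (fun p q => ?_) i)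
      (le_max_left _ _)
    · rintro ⟨i, a⟩ ⟨j, c⟩ h
      simp only [Prod.mk.injEq, Nat.cast_inj, Fin.val_inj] at h
      exact Prod.ext h.1 h.2
    · rw [hM]
      rfl
  have hint : Integrable (fun θ => (hermitianFun f (T θ)).trace) μ :=
    integrable_trace_hermitianFun hTbdd hK0 hKT f hf
  refine ⟨?_, ?_⟩
  · rw [intervalIntegrable_iff_integrableOn_Ioc_of_le hpi, IntegrableOn,
      ← restrict_Ico_eq_restrict_Ioc]
    exact hint
  have hpoly : ∀ p : Polynomial ℂ, Tendsto (fun n : ℕ =>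
      (hermitianFun (fun x => p.eval (x : ℂ)) (truncation (blockToeplitz T) (n + 1))).trace -
      (hermitianFun (fun x => p.eval (x : ℂ)) (truncation (blockToeplitz T) n)).trace) atTop
      (𝓝 (1 / (2 * (Real.pi : ℂ)) *
        ∫ θ, (hermitianFun (fun x => p.eval (x : ℂ)) (T θ)).trace ∂μ)) := by
    intro p
    have h := tendsto_finsetSum (Finset.range (p.natDegree + 1)) fun k _ =>
      (tendsto_trace_truncation_pow T b M hM k).const_mul (p.coeff k)
    convert h using 2 with n
    · rw [trace_hermitianFun_polynomial (hA _), trace_hermitianFun_polynomial (hA _),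
        ← Finset.sum_sub_distrib]
      simp only [mul_sub]
    · rw [integral_trace_polynomial hTbdd hH, Finset.mul_sum]
      refine Finset.sum_congr rfl fun k _ => ?_
      simp only [hMk, hμI, ← Finset.mul_sum]
      ring
  rw [hμI, Metric.tendsto_atTop]
  intro δ hδ
  -- Replacing `f` by `p` costs `d * ε` in the increments and `d * ε` in the limit.
  set ε : ℝ := δ / (3 * (d + 1)) with hε
  have hε0 : 0 < ε := by positivity
  have hdε : d * ε < δ / 3 := by
    rw [hε, mul_div_assoc', div_lt_div_iff₀ (by positivity) (by positivity)]
    nlinarith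
  obtain ⟨p, h, h1, h2, h3⟩ := exists_polynomial_near_of_absolutelyContinuous f hf hK0 hε0
  obtain ⟨N, hN⟩ := Metric.tendsto_atTop.1 (hpoly p) (δ / 3) (by positivity)
  refine ⟨N, fun n hn => ?_⟩
  have hL : ‖1 / (2 * (Real.pi : ℂ)) * ∫ θ, (hermitianFun f (T θ)).trace ∂μ -
      1 / (2 * (Real.pi : ℂ)) *
        ∫ θ, (hermitianFun (fun x => p.eval (x : ℂ)) (T θ)).trace ∂μ‖ ≤ d * ε := by
    rw [← mul_sub, ← integral_sub hint (integrable_trace_polynomial hTbdd hH p), norm_mul]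
    have hb : ‖∫ θ, ((hermitianFun f (T θ)).trace -
        (hermitianFun (fun x => p.eval (x : ℂ)) (T θ)).trace) ∂μ‖ ≤ d * ε * (2 * Real.pi) := by
      rw [← hμu]
      refine norm_integral_le_of_norm_le_const ?_
      filter_upwards [hKT] with θ hθ
      obtain ⟨hAθ, hθ⟩ := hθ
      simpa using norm_trace_hermitianFun_sub_le hAθ hθ fun x hx =>
        norm_le_of_eq_neg_integral (g := fun x => f x - p.eval (x : ℂ)) h1 h2 (h3 x) hx
    have hc : ‖1 / (2 * (Real.pi : ℂ))‖ = 1 / (2 * Real.pi) := by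
      rw [norm_div, norm_one, norm_mul, Complex.norm_real, Real.norm_of_nonneg Real.pi_pos.le]
      norm_num
    rw [hc, one_div, inv_mul_le_iff₀ (by positivity)]
    linarith
  have hI : ‖((hermitianFun f (truncation (blockToeplitz T) (n + 1))).trace -
      (hermitianFun f (truncation (blockToeplitz T) n)).trace) -
      ((hermitianFun (fun x => p.eval (x : ℂ)) (truncation (blockToeplitz T) (n + 1))).trace -
      (hermitianFun (fun x => p.eval (x : ℂ)) (truncation (blockToeplitz T) n)).trace)‖ ≤
      d * ε := by
    obtain ⟨V, hV, hVB⟩ := truncation_eq_compression (blockToeplitz T) n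
    have hv := norm_sum_eigenvalues_sub_le (hA (n + 1)) (hA n) hV hVB hK0 (hKA _) (hKA _)
      (g := fun x => f x - p.eval (x : ℂ)) h1 fun x _ => h3 x
    rw [trace_hermitianFun (hA _), trace_hermitianFun (hA _), trace_hermitianFun (hA _),
      trace_hermitianFun (hA _), sub_sub_sub_comm, ← Finset.sum_sub_distrib,
      ← Finset.sum_sub_distrib]
    refine hv.trans ?_
    have hcard : ((Fintype.card (Fin (n + 1) × Fin d) : ℝ) - Fintype.card (Fin n × Fin d)) = d := by
      simp
      ring
    rw [hcard]
    gcongr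
  have hPn := hN n hn
  rw [Complex.dist_eq] at hPn ⊢
  rw [← norm_neg, neg_sub] at hL
  -- Compare the increments for `f`, those for `p`, the limit for `p`, and the limit for `f`.
  have e1 := norm_sub_le_norm_sub_add_norm_sub
    ((hermitianFun f (truncation (blockToeplitz T) (n + 1))).trace -
      (hermitianFun f (truncation (blockToeplitz T) n)).trace)
    ((hermitianFun (fun x => p.eval (x : ℂ)) (truncation (blockToeplitz T) (n + 1))).trace -
      (hermitianFun (fun x => p.eval (x : ℂ)) (truncation (blockToeplitz T) n)).trace)
    (1 / (2 * (Real.pi : ℂ)) * ∫ θ, (hermitianFun f (T θ)).trace ∂μ)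
  have e2 := norm_sub_le_norm_sub_add_norm_sub
    ((hermitianFun (fun x => p.eval (x : ℂ)) (truncation (blockToeplitz T) (n + 1))).trace -
      (hermitianFun (fun x => p.eval (x : ℂ)) (truncation (blockToeplitz T) n)).trace)
    (1 / (2 * (Real.pi : ℂ)) *
      ∫ θ, (hermitianFun (fun x => p.eval (x : ℂ)) (T θ)).trace ∂μ)
    (1 / (2 * (Real.pi : ℂ)) * ∫ θ, (hermitianFun f (T θ)).trace ∂μ)
  linarith
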